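/- Let $\mathbf{Top}$ be the category of topological spaces, $\mathbf{Top}^{\mathbf 2}$ its category of arrows, and $\mathcal J$ the set of inclusions $\partial j=S^{n-1}\to \bar\jmath=D^n$, $n\ge 0$ (with $S^{-1}=\emptyset$). *Cell complexes.* A stratum $(X,S)$ is a space $X$ with a set $S$ of cells and, for each $s\in S$, some $\kappa_s\in\mathcal J$ and a continuous map $b_s\colon\partial\kappa_s\to X$; its body $\overline{(X,S)}$ is the pushout of $\coprod_s\partial\kappa_s\to\coprod_s\bar\kappa_s$ along $\langle b_s\rangle\colon\coprod_s\partial\kappa_s\to X$. A morphism $(f,p)\colon(X,S)\to(Y,T)$ is a continuous $f\colon X\to Y$ and a function $p\colon S\to T$ with $\kappa_{p(s)}=\kappa_s$ and $f b_s=b_{p(s)}$; it induces a map of bodies. A relative cell complex is a sequence of strata $(X_n,S_n)_{n\in\mathbb N}$ with $X_{n+1}=\overline{(X_n,S_n)}$ such that for no $s\in S_n$ does $b_s$ factor through $X_m$ with $m<n$. Its body is $\operatorname{colim}_n X_n$ and its boundary is $X_0$. A morphism is a sequence of morphisms of strata $(f_n,p_n)$ with $f_{n+1}=\overline{(f_n,p_n)}$.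 This gives a category $\mathbf{CellCx}$ with a functor $U\colon\mathbf{CellCx}\to\mathbf{Top}^{\mathbf 2}$ sending a complex $A$ to the map $\partial A\to\bar A$ from its boundary to its body. *Free cell complexes.* For $f\colon A\to B$ put $A_0=A$, $E_0f=f$; let $S_n$ be the set of commutative squares from some $j\in\mathcal J$ to $E_nf\colon A_n\to B$ whose boundary map $\partial j\to A_n$ does not factor through $A_{n-1}$ (no condition if $n=0$), let $A_{n+1}=\overline{(A_n,S_n)}$, and let $E_{n+1}f\colon A_{n+1}\to B$ be induced by $E_nf$ and the squares. This defines a cell complex $Kf$ with boundary $A$ and a map $Ef\colon\overline{Kf}\to B$ with $Ef\circ UKf=f$. *Composition.* Let $A=(X_n,S_n)$ be a cell complex and $(Y,T)$ a stratum with $Y=\bar A$. Their composite has boundary $X_0$ and as cells in level $n$ those of $S_n$ together with those $t\in T$ for which $n$ is the smallest number such that $b_t$ factors through $X_n$. If $B$ is a cell complex with $\partial B=\bar A$, then $B*A$ is the colimit of the sequence obtained from $A$ by composing the strata of $B$ onto it one after the other. **Proposition.** 1. $K$ extends to a functor right adjoint to $U$, with counit $(1,Ef)\colon UKf\to f$.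 Hence $UK$ is a comonad on $\mathbf{Top}^{\mathbf 2}$, with counit $(1,Ef)$, and $f\mapsto(UKf,Ef)$ is a functorial factorisation; in particular $E$ is an endofunctor of $\mathbf{Top}^{\mathbf 2}$, pointed by $\vec\eta_f=(UKf,1)$. 2. Whenever $\partial B=\bar A$, the composite $B*A$ exists as a cell complex, and its underlying map is the composite of the underlying maps of $A$ and $B$. 3. Let $\mu_f\colon\overline{KEf}\to\overline{Kf}$ be the body part of the cell complex morphism $KEf*Kf\to Kf$ that corresponds under the adjunction to $(1,EEf)\colon U(KEf*Kf)\to f$. Then $\vec\mu_f=(\mu_f,1)$ is natural and makes $(E,\vec\eta,\vec\mu)$ a monad on $\mathbf{Top}^{\mathbf 2}$. 4. $(UK,E)$ is an algebraic weak factorisation system on $\mathbf{Top}$: writing $\vec\delta_f=(1,\delta_f)$ for the comultiplication of $UK$, the squares $(\delta_f,\mu_f)\colon UKEf\to EUKf$ form a natural transformation $\Delta\colon UK\,E\Rightarrow E\,UK$ that is a distributive law of the comonad $UK$ over the monad $E$, i.e. it is compatible with the unit and multiplication of $E$ and with the counit and comultiplication of $UK$. -/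

import Mathlib

open CategoryTheory CategoryTheory.Limits TopCat

universe u v w

noncomputable section

/-! ### Strata -/

/-- A stratum `(X, S)`: a space `X`, a set `S` of cells and, for every cell `s`, a generating
map `κ s` (the inclusion `∂𝔻 n ⟶ 𝔻 n` with `n = κ s`; it is `∅ ⟶ pt` for `n = 0`) with a
continuous attaching map `b s` from its boundary to `X`. -/
structure Stratum where
  X : TopCat.{u}
  S : Type u
  κ : S → ℕ
  b : ∀ s : S, diskBoundary.{u} (κ s) ⟶ X

namespace Stratum

/-- The body of a stratum: all cells are glued onto `X` along their attaching maps. -/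
def body (P : Stratum.{u}) : TopCat.{u} :=
  pushout (Sigma.desc P.b) (Limits.Sigma.map fun s : P.S => diskBoundaryInclusion.{u} (P.κ s))

/-- The map from the boundary of a stratum to its body. -/
def incl (P : Stratum.{u}) : P.X ⟶ P.body := pushout.inl _ _

/-- The characteristic map of a cell. -/
def cell (P : Stratum.{u}) (s : P.S) : disk.{u} (P.κ s) ⟶ P.body :=
  Sigma.ι (fun s : P.S => disk.{u} (P.κ s)) s ≫ pushout.inr _ _

theorem condition (P : Stratum.{u}) (s : P.S) :
    P.b s ≫ P.incl = diskBoundaryInclusion (P.κ s) ≫ P.cell s := by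
  have h := Sigma.ι (fun s : P.S => diskBoundary.{u} (P.κ s)) s ≫=
    (pushout.condition (f := Sigma.desc P.b)
      (g := Limits.Sigma.map fun s : P.S => diskBoundaryInclusion.{u} (P.κ s)))
  simp only [ι_colimMap_assoc, Discrete.natTrans_app, colimit.ι_desc_assoc, Cofan.mk_ι_app,
    Limits.Sigma.map] at h
  exact h

/-- A map out of the body is given by a map out of the boundary and compatible maps out of
the cells. -/
def desc (P : Stratum.{u}) {W : TopCat.{u}} (g : P.X ⟶ W) (c : ∀ s, disk.{u} (P.κ s) ⟶ W)
    (h : ∀ s, P.b s ≫ g = diskBoundaryInclusion (P.κ s) ≫ c s) : P.body ⟶ W :=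
  pushout.desc g (Sigma.desc c) (by ext1 s; simpa using h s)

@[simp]
theorem incl_desc (P : Stratum.{u}) {W : TopCat.{u}} (g : P.X ⟶ W)
    (c : ∀ s, disk.{u} (P.κ s) ⟶ W)
    (h : ∀ s, P.b s ≫ g = diskBoundaryInclusion (P.κ s) ≫ c s) :
    P.incl ≫ P.desc g c h = g :=
  pushout.inl_desc _ _ _

@[simp]
theorem cell_desc (P : Stratum.{u}) {W : TopCat.{u}} (g : P.X ⟶ W)
    (c : ∀ s, disk.{u} (P.κ s) ⟶ W)
    (h : ∀ s, P.b s ≫ g = diskBoundaryInclusion (P.κ s) ≫ c s) (s : P.S) :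
    P.cell s ≫ P.desc g c h = c s :=
  (Category.assoc _ _ _).trans
    ((congrArg _ (pushout.inr_desc _ _ _)).trans (Limits.Sigma.ι_desc _ _))

theorem body_hom_ext (P : Stratum.{u}) {W : TopCat.{u}} {g h : P.body ⟶ W}
    (h₁ : P.incl ≫ g = P.incl ≫ h) (h₂ : ∀ s, P.cell s ≫ g = P.cell s ≫ h) : g = h := by
  apply pushout.hom_ext h₁
  ext1 s
  exact (Category.assoc _ _ _).symm.trans ((h₂ s).trans (Category.assoc _ _ _))

/-- A morphism of strata: a continuous map `f` and a map `p` of cells, preserving the shape of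
every cell and its attaching map. -/
@[ext]
structure Hom (P Q : Stratum.{u}) where
  f : P.X ⟶ Q.X
  p : P.S → Q.S
  hκ : ∀ s, P.κ s = Q.κ (p s)
  hb : ∀ s, P.b s ≫ f = eqToHom (congrArg diskBoundary.{u} (hκ s)) ≫ Q.b (p s)

instance : Category Stratum.{u} where
  Hom := Hom
  id P := { f := 𝟙 _, p := id, hκ := fun _ => rfl, hb := fun _ => by simp }
  comp φ ψ :=
    { f := φ.f ≫ ψ.f
      p := ψ.p ∘ φ.p
      hκ := fun s => (φ.hκ s).trans (ψ.hκ _)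
      hb := fun s => by
        rw [← Category.assoc, φ.hb, Category.assoc, ψ.hb, ← Category.assoc, eqToHom_trans]
        rfl }

@[simp] theorem id_f (P : Stratum.{u}) : Hom.f (𝟙 P) = 𝟙 P.X := rfl
@[simp] theorem id_p (P : Stratum.{u}) (s : P.S) : Hom.p (𝟙 P) s = s := rfl
@[simp] theorem comp_f {P Q R : Stratum.{u}} (φ : P ⟶ Q) (ψ : Q ⟶ R) :
    Hom.f (φ ≫ ψ) = φ.f ≫ ψ.f := rfl
@[simp] theorem comp_p {P Q R : Stratum.{u}} (φ : P ⟶ Q) (ψ : Q ⟶ R) (s : P.S) :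
    Hom.p (φ ≫ ψ) s = ψ.p (φ.p s) := rfl

@[ext]
theorem hom_ext {P Q : Stratum.{u}} {φ ψ : P ⟶ Q} (h₁ : φ.f = ψ.f) (h₂ : φ.p = ψ.p) : φ = ψ :=
  Hom.ext h₁ h₂

theorem boundary_eqToHom {m n : ℕ} (h : m = n) :
    diskBoundaryInclusion.{u} m ≫ eqToHom (congrArg disk.{u} h) =
      eqToHom (congrArg diskBoundary.{u} h) ≫ diskBoundaryInclusion.{u} n := by
  subst h; simp

/-- The map between the bodies induced by a morphism of strata: it is `f` on the boundary and
maps the cell `s` identically to the cell `p s`. -/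
def bodyMap {P Q : Stratum.{u}} (φ : P ⟶ Q) : P.body ⟶ Q.body :=
  P.desc (φ.f ≫ Q.incl) (fun s => eqToHom (congrArg disk.{u} (φ.hκ s)) ≫ Q.cell (φ.p s))
    (fun s => by
      rw [← Category.assoc, φ.hb, Category.assoc, condition, ← Category.assoc, ← Category.assoc,
        boundary_eqToHom (φ.hκ s)])

@[simp]
theorem incl_bodyMap {P Q : Stratum.{u}} (φ : P ⟶ Q) :
    P.incl ≫ bodyMap φ = φ.f ≫ Q.incl := by simp [bodyMap]

@[simp]
theorem cell_bodyMap {P Q : Stratum.{u}} (φ : P ⟶ Q) (s : P.S) :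
    P.cell s ≫ bodyMap φ = eqToHom (congrArg disk.{u} (φ.hκ s)) ≫ Q.cell (φ.p s) := by
  simp [bodyMap]

theorem bodyMap_id (P : Stratum.{u}) : bodyMap (𝟙 P) = 𝟙 _ := by
  apply body_hom_ext
  · simp
  · intro s; simp

theorem bodyMap_comp {P Q R : Stratum.{u}} (φ : P ⟶ Q) (ψ : Q ⟶ R) :
    bodyMap (φ ≫ ψ) = bodyMap φ ≫ bodyMap ψ := by
  apply body_hom_ext
  · rw [← Category.assoc, incl_bodyMap, incl_bodyMap, Category.assoc, incl_bodyMap]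
    simp
  · intro s
    rw [← Category.assoc, cell_bodyMap, cell_bodyMap, Category.assoc, cell_bodyMap]
    simp

end Stratum

/-! ### Cell complexes -/

/-- A connected sequence of strata: the boundary of each stratum is the body of the previous
one. -/
structure StrataSeq where
  st : ℕ → Stratum.{u}
  connected : ∀ n, (st n).body = (st (n + 1)).X

namespace StrataSeq

/-- The space `X n`, the boundary of the `n`-th stratum. -/
abbrev X (A : StrataSeq.{u}) (n : ℕ) : TopCat.{u} := (A.st n).X

/-- The identification of the body of a stratum with the boundary of the next one. -/
def glue (A : StrataSeq.{u}) (n : ℕ) : (A.st n).body ≅ A.X (n + 1) := eqToIso (A.connected n)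

/-- The map `X n ⟶ X (n + 1)` underlying the `n`-th stratum. -/
def step (A : StrataSeq.{u}) (n : ℕ) : A.X n ⟶ A.X (n + 1) := (A.st n).incl ≫ (A.glue n).hom

/-- The diagram `X 0 ⟶ X 1 ⟶ X 2 ⟶ ⋯`. -/
def diagram (A : StrataSeq.{u}) : ℕ ⥤ TopCat.{u} := Functor.ofSequence (X := A.X) A.step

/-- The map `X m ⟶ X n` for `m ≤ n`. -/
def trans (A : StrataSeq.{u}) {m n : ℕ} (h : m ≤ n) : A.X m ⟶ A.X n := A.diagram.map (homOfLE h)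

theorem trans_succ (A : StrataSeq.{u}) {m n : ℕ} (h : m ≤ n) :
    A.trans (h.trans n.le_succ) = A.trans h ≫ A.step n := by
  have : A.step n = A.diagram.map (homOfLE n.le_succ) :=
    (Functor.ofSequence_map_homOfLE_succ (X := A.X) A.step n).symm
  rw [this]
  exact A.diagram.map_comp (homOfLE h) (homOfLE n.le_succ)

/-- A sequence is proper if no attaching map in the `n`-th stratum factors through the boundary
of a lower stratum. -/
def IsProper (A : StrataSeq.{u}) : Prop :=
  ∀ (n : ℕ) (s : (A.st n).S) (m : ℕ) (h : m < n),
    ¬ ∃ g : diskBoundary.{u} ((A.st n).κ s) ⟶ A.X m, g ≫ A.trans h.le = (A.st n).b s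

/-- The body of a sequence of strata, the colimit of `X 0 ⟶ X 1 ⟶ X 2 ⟶ ⋯`. -/
def body (A : StrataSeq.{u}) : TopCat.{u} := colimit A.diagram

/-- The canonical map from `X n` to the body. -/
def toBody (A : StrataSeq.{u}) (n : ℕ) : A.X n ⟶ A.body := colimit.ι A.diagram n

@[simp]
theorem step_toBody (A : StrataSeq.{u}) (n : ℕ) : A.step n ≫ A.toBody (n + 1) = A.toBody n := by
  have h := colimit.w A.diagram (homOfLE (Nat.le_add_right n 1))
  rwa [diagram, Functor.ofSequence_map_homOfLE_succ] at h

/-- The natural transformation out of the diagram of `A` given by maps commuting with the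
steps. -/
def natTrans (A : StrataSeq.{u}) (G : ℕ ⥤ TopCat.{u}) (c : ∀ n, A.X n ⟶ G.obj n)
    (h : ∀ n, A.step n ≫ c (n + 1) = c n ≫ G.map (homOfLE (n.le_add_right 1))) :
    A.diagram ⟶ G :=
  NatTrans.ofSequence c (fun n =>
    (congrArg (fun g : A.X n ⟶ A.X (n + 1) => g ≫ c (n + 1))
      (Functor.ofSequence_map_homOfLE_succ (X := A.X) A.step n)).trans (h n))

/-- The map out of the body given by compatible maps out of all `X n`. -/
def bodyDesc (A : StrataSeq.{u}) {W : TopCat.{u}} (c : ∀ n, A.X n ⟶ W)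
    (h : ∀ n, A.step n ≫ c (n + 1) = c n) : A.body ⟶ W :=
  colimit.desc A.diagram ⟨W, A.natTrans ((Functor.const ℕ).obj W) c (fun n => by
    rw [h n]; exact (Category.comp_id _).symm)⟩

@[simp]
theorem toBody_bodyDesc (A : StrataSeq.{u}) {W : TopCat.{u}} (c : ∀ n, A.X n ⟶ W)
    (h : ∀ n, A.step n ≫ c (n + 1) = c n) (n : ℕ) : A.toBody n ≫ A.bodyDesc c h = c n :=
  colimit.ι_desc _ _

theorem body_hom_ext (A : StrataSeq.{u}) {W : TopCat.{u}} {g h : A.body ⟶ W}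
    (H : ∀ n, A.toBody n ≫ g = A.toBody n ≫ h) : g = h :=
  colimit.hom_ext H

/-- A morphism: a coherent sequence of morphisms of strata. -/
@[ext]
structure Hom (A B : StrataSeq.{u}) where
  φ : ∀ n, A.st n ⟶ B.st n
  coherent : ∀ n, (A.glue n).hom ≫ (φ (n + 1)).f = Stratum.bodyMap (φ n) ≫ (B.glue n).hom

instance : Category StrataSeq.{u} where
  Hom := Hom
  id A := { φ := fun n => 𝟙 _, coherent := fun n => by simp [Stratum.bodyMap_id] }
  comp f g :=
    { φ := fun n => f.φ n ≫ g.φ n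
      coherent := fun n => by
        rw [Stratum.comp_f, ← Category.assoc, f.coherent, Category.assoc, g.coherent,
          Stratum.bodyMap_comp, Category.assoc] }

@[simp] theorem id_φ (A : StrataSeq.{u}) (n : ℕ) : Hom.φ (𝟙 A) n = 𝟙 _ := rfl
@[simp] theorem comp_φ {A B C : StrataSeq.{u}} (f : A ⟶ B) (g : B ⟶ C) (n : ℕ) :
    Hom.φ (f ≫ g) n = f.φ n ≫ g.φ n := rfl

@[ext]
theorem hom_ext {A B : StrataSeq.{u}} {f g : A ⟶ B} (h : ∀ n, f.φ n = g.φ n) : f = g :=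
  Hom.ext (funext h)

theorem step_naturality {A B : StrataSeq.{u}} (f : A ⟶ B) (n : ℕ) :
    A.step n ≫ (f.φ (n + 1)).f = (f.φ n).f ≫ B.step n := by
  rw [step, Category.assoc, f.coherent, ← Category.assoc, Stratum.incl_bodyMap, step,
    Category.assoc]

/-- The map between the bodies induced by a morphism. -/
def bodyMap {A B : StrataSeq.{u}} (f : A ⟶ B) : A.body ⟶ B.body :=
  A.bodyDesc (fun n => (f.φ n).f ≫ B.toBody n) (fun n => by
    rw [← Category.assoc, step_naturality, Category.assoc, step_toBody])

@[simp]
theorem toBody_bodyMap {A B : StrataSeq.{u}} (f : A ⟶ B) (n : ℕ) :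
    A.toBody n ≫ bodyMap f = (f.φ n).f ≫ B.toBody n := by simp [bodyMap]

theorem bodyMap_id (A : StrataSeq.{u}) : bodyMap (𝟙 A) = 𝟙 _ := by
  apply body_hom_ext; intro n; simp

theorem bodyMap_comp {A B C : StrataSeq.{u}} (f : A ⟶ B) (g : B ⟶ C) :
    bodyMap (f ≫ g) = bodyMap f ≫ bodyMap g := by
  apply body_hom_ext; intro n
  rw [toBody_bodyMap, ← Category.assoc, toBody_bodyMap, Category.assoc, toBody_bodyMap]
  simp

/-- The underlying map `X 0 ⟶ body`, the transfinite composite of all strata, as a functor to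
the arrow category. -/
def underlying : StrataSeq.{u} ⥤ Arrow TopCat.{u} where
  obj A := Arrow.mk (A.toBody 0)
  map {A B} f := Arrow.homMk (u := (f.φ 0).f) (v := bodyMap f) (by simp)
  map_id A := by
    ext1
    · rfl
    · exact bodyMap_id A
  map_comp f g := by
    ext1
    · rfl
    · exact bodyMap_comp f g

end StrataSeq

/-- The category of relative cell complexes, i.e. of proper connected sequences of strata. -/
abbrev CellCx : Type (u + 1) :=
  ObjectProperty.FullSubcategory (C := StrataSeq.{u}) StrataSeq.IsProper

/-- The forgetful functor from cell complexes to the arrow category of `Top`. -/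
def CellCx.U : CellCx.{u} ⥤ Arrow TopCat.{u} :=
  ObjectProperty.ι (C := StrataSeq.{u}) StrataSeq.IsProper ⋙ StrataSeq.underlying

/-! ### The free cell complex on a map -/

/-- A stage of the construction of the free cell complex over `B`: the space built so far, its
map to `B`, and the predicate saying which attaching maps would be improper. -/
structure FreeStage (B : TopCat.{u}) where
  X : TopCat.{u}
  e : X ⟶ B
  improper : ∀ n : ℕ, (diskBoundary.{u} n ⟶ X) → Prop

namespace FreeStage

variable {B : TopCat.{u}}

/-- The stratum with one cell for each commutative square from a generating map to `e` whose
boundary map is not improper. -/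
def stratum (F : FreeStage.{u} B) : Stratum.{u} where
  X := F.X
  S := { s : Σ n : ℕ, (Arrow.mk (diskBoundaryInclusion.{u} n) ⟶ Arrow.mk F.e) //
    ¬ F.improper s.1 s.2.left }
  κ s := s.1.1
  b s := s.1.2.left

/-- The next stage: the space is the body of the stratum, its map to `B` is induced by the
squares, and an attaching map is improper if it factors through the present space. -/
def next (F : FreeStage.{u} B) : FreeStage.{u} B where
  X := F.stratum.body
  e := F.stratum.desc F.e (fun s => s.1.2.right) (fun s => Arrow.w s.1.2)
  improper n g := ∃ g' : diskBoundary.{u} n ⟶ F.X, g' ≫ F.stratum.incl = g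

end FreeStage

/-- The stages for `f : A ⟶ B`, starting with `f` itself and no improper attaching map. -/
def freeStage (f : Arrow TopCat.{u}) : ℕ → FreeStage.{u} f.right
  | 0 => { X := f.left, e := f.hom, improper := fun _ _ => False }
  | n + 1 => (freeStage f n).next

/-- The sequence of strata of the free cell complex on `f`. -/
def freeSeq (f : Arrow TopCat.{u}) : StrataSeq.{u} where
  st n := (freeStage f n).stratum
  connected _ := rfl

theorem freeSeq_step (f : Arrow TopCat.{u}) (n : ℕ) :
    (freeSeq f).step n = (freeStage f n).stratum.incl := Category.comp_id _

theorem freeSeq_isProper (f : Arrow TopCat.{u}) : (freeSeq f).IsProper := by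
  rintro (_ | n) s m h ⟨g, hg⟩
  · exact absurd h (Nat.not_lt_zero m)
  · refine s.2 ⟨g ≫ (freeSeq f).trans (Nat.lt_succ_iff.1 h), ?_⟩
    rw [StrataSeq.trans_succ (freeSeq f) (Nat.lt_succ_iff.1 h), freeSeq_step] at hg
    exact (Category.assoc _ _ _).trans hg

/-- The free cell complex `K f` on a map `f`. -/
def freeCx (f : Arrow TopCat.{u}) : CellCx.{u} := ⟨freeSeq f, freeSeq_isProper f⟩

/-- The map `E f` from the body of `K f` to the codomain of `f`, induced by the maps of the
stages. -/
def freeE (f : Arrow TopCat.{u}) : (freeSeq f).body ⟶ f.right :=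
  (freeSeq f).bodyDesc (fun n => (freeStage f n).e) (fun n => by
    rw [freeSeq_step]
    exact (freeStage f n).stratum.incl_desc _ _ (fun s => Arrow.w s.1.2))

theorem toBody_freeE (f : Arrow TopCat.{u}) : (freeSeq f).toBody 0 ≫ freeE f = f.hom :=
  (freeSeq f).toBody_bodyDesc (fun n => (freeStage f n).e) _ 0

/-- The canonical morphism `(1, E f)` from the underlying map of `K f` to `f`. -/
def freeCounit (f : Arrow TopCat.{u}) : CellCx.U.obj (freeCx f) ⟶ f :=
  Arrow.homMk (u := 𝟙 f.left) (v := freeE f)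
    ((Category.id_comp _).trans (toBody_freeE f).symm)

/-- The universal property of the free cell complexes. -/
def FreeProperty : Prop :=
  ∀ (C : CellCx.{u}) (f : Arrow TopCat.{u}) (α : CellCx.U.obj C ⟶ f),
    ∃! φ : C ⟶ freeCx f, CellCx.U.map φ ≫ freeCounit f = α

namespace FreeProperty

/-- The bijection between maps `U C ⟶ f` and morphisms `C ⟶ K f`. -/
def equiv (h : FreeProperty.{u}) (C : CellCx.{u}) (f : Arrow TopCat.{u}) :
    (CellCx.U.obj C ⟶ f) ≃ (C ⟶ freeCx f) where
  toFun α := (h C f α).choose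
  invFun φ := CellCx.U.map φ ≫ freeCounit f
  left_inv α := (h C f α).choose_spec.1
  right_inv φ := ((h C f (CellCx.U.map φ ≫ freeCounit f)).choose_spec.2 φ rfl).symm

theorem equiv_naturality (h : FreeProperty.{u}) (C' C : CellCx.{u}) (f : Arrow TopCat.{u})
    (φ : C' ⟶ C) (α : CellCx.U.obj C ⟶ f) :
    h.equiv C' f (CellCx.U.map φ ≫ α) = φ ≫ h.equiv C f α := by
  rw [← Equiv.eq_symm_apply]
  change _ = CellCx.U.map (φ ≫ h.equiv C f α) ≫ freeCounit f
  rw [Functor.map_comp, Category.assoc]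
  congr 1
  exact ((h.equiv C f).symm_apply_apply α).symm

/-- The functor `K`, given on objects by the free cell complexes. -/
def K (h : FreeProperty.{u}) : Arrow TopCat.{u} ⥤ CellCx.{u} :=
  Adjunction.rightAdjointOfEquiv h.equiv h.equiv_naturality

/-- The adjunction between `U` and `K`, with counit `(1, E f)`. -/
def adj (h : FreeProperty.{u}) : CellCx.U.{u} ⊣ h.K :=
  Adjunction.adjunctionOfEquivRight h.equiv h.equiv_naturality

/-- The comonad `UK` of the adjunction. -/
def comonad (h : FreeProperty.{u}) : Comonad (Arrow TopCat.{u}) := h.adj.toComonad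

theorem U_map_K_map (h : FreeProperty.{u}) {f g : Arrow TopCat.{u}} (α : f ⟶ g) :
    CellCx.U.map (h.K.map α) ≫ freeCounit g = freeCounit f ≫ α := by
  refine ((h.equiv _ _).symm_apply_apply _).trans ?_
  change (CellCx.U.map (𝟙 _) ≫ freeCounit f) ≫ α = _
  rw [CategoryTheory.Functor.map_id, Category.id_comp]

end FreeProperty

/-! ### Algebraic weak factorisation systems -/

/-- A functorial factorisation `f ↦ (dom f ⟶ M f ⟶ cod f)`; the central functor `M` is `Z`, the
two factors are `i` and `p`. -/
abbrev FunctorialFactorisation (C : Type v) [Category.{w} C] :=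
  MorphismProperty.FunctorialFactorizationData (⊤ : MorphismProperty C) (⊤ : MorphismProperty C)

namespace FunctorialFactorisation

variable {C : Type v} [Category.{w} C] (F : FunctorialFactorisation C)

/-- The left endofunctor of the arrow category. -/
def L : Arrow C ⥤ Arrow C where
  obj f := Arrow.mk (F.i.app f)
  map {f g} α := Arrow.homMk (u := α.left) (v := F.Z.map α) (F.i.naturality α)

/-- The right endofunctor of the arrow category. -/
def R : Arrow C ⥤ Arrow C where
  obj f := Arrow.mk (F.p.app f)
  map {f g} α := Arrow.homMk (u := F.Z.map α) (v := α.right) (F.p.naturality α)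

/-- The counit `(1, R f)` of the left functor. -/
def ε : F.L ⟶ 𝟭 (Arrow C) where
  app f := Arrow.homMk (u := 𝟙 f.left) (v := F.p.app f)
    ((Category.id_comp _).trans F.fac_app.symm)
  naturality f g α := by
    ext1
    · exact (Category.comp_id _).trans (Category.id_comp _).symm
    · exact F.p.naturality α

/-- The unit `(L f, 1)` of the right functor. -/
def η : 𝟭 (Arrow C) ⟶ F.R where
  app f := Arrow.homMk (u := F.i.app f) (v := 𝟙 f.right)
    (F.fac_app.trans (Category.comp_id _).symm)
  naturality f g α := by
    ext1
    · exact F.i.naturality α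
    · exact (Category.comp_id _).trans (Category.id_comp _).symm

end FunctorialFactorisation

/-- An algebraic weak factorisation system with underlying functorial factorisation `F`: the
copointed functor `(L, ε)` is extended to a comonad, the pointed functor `(R, η)` is extended to
a monad, and the maps `(δ_f, μ_f) : L R f ⟶ R L f` form a distributive law of the comonad over
the monad. -/
structure AlgebraicWFS {C : Type v} [Category.{w} C] (F : FunctorialFactorisation C) where
  δ : F.L ⟶ F.L ⋙ F.L
  coassoc : ∀ f, δ.app f ≫ F.L.map (δ.app f) = δ.app f ≫ δ.app (F.L.obj f)
  left_counit : ∀ f, δ.app f ≫ F.ε.app (F.L.obj f) = 𝟙 (F.L.obj f)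
  right_counit : ∀ f, δ.app f ≫ F.L.map (F.ε.app f) = 𝟙 (F.L.obj f)
  μ : F.R ⋙ F.R ⟶ F.R
  assoc : ∀ f, F.R.map (μ.app f) ≫ μ.app f = μ.app (F.R.obj f) ≫ μ.app f
  left_unit : ∀ f, F.η.app (F.R.obj f) ≫ μ.app f = 𝟙 (F.R.obj f)
  right_unit : ∀ f, F.R.map (F.η.app f) ≫ μ.app f = 𝟙 (F.R.obj f)
  Δ : F.R ⋙ F.L ⟶ F.L ⋙ F.R
  Δ_left : ∀ f, (Δ.app f).left = (δ.app f).right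
  Δ_right : ∀ f, (Δ.app f).right = (μ.app f).left
  Δ_unit : ∀ f, F.L.map (F.η.app f) ≫ Δ.app f = F.η.app (F.L.obj f)
  Δ_counit : ∀ f, Δ.app f ≫ F.R.map (F.ε.app f) = F.ε.app (F.R.obj f)
  Δ_mul : ∀ f, F.L.map (μ.app f) ≫ Δ.app f =
    Δ.app (F.R.obj f) ≫ F.R.map (Δ.app f) ≫ μ.app (F.L.obj f)
  Δ_comul : ∀ f, Δ.app f ≫ F.R.map (δ.app f) =
    δ.app (F.R.obj f) ≫ F.L.map (Δ.app f) ≫ Δ.app (F.L.obj f)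

namespace AlgebraicWFS

variable {C : Type v} [Category.{w} C] {F : FunctorialFactorisation C}

/-- The comonad of an algebraic weak factorisation system. -/
def comonad (W : AlgebraicWFS F) : Comonad (Arrow C) where
  toFunctor := F.L
  ε := F.ε
  δ := W.δ
  coassoc := W.coassoc
  left_counit := W.left_counit
  right_counit := W.right_counit

/-- The monad of an algebraic weak factorisation system. -/
def monad (W : AlgebraicWFS F) : Monad (Arrow C) where
  toFunctor := F.R
  η := F.η
  μ := W.μ
  assoc := W.assoc
  left_unit := W.left_unit
  right_unit := W.right_unit

end AlgebraicWFS

/-- The functorial factorisation of `f` into the underlying map of `K f` followed by `E f`. Its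
right functor is the endofunctor `E`, which takes a square `(a, b)` to the square with top side
the body of `K (a, b)` and bottom side `b`. -/
def cellFactorisation (h : FreeProperty.{u}) : FunctorialFactorisation TopCat.{u} where
  Z := h.K ⋙ CellCx.U ⋙ Arrow.rightFunc
  i :=
    { app := fun f => (CellCx.U.obj (freeCx f)).hom
      naturality := fun f g α => by
        have h₁ := congrArg Arrow.Hom.left (h.U_map_K_map α)
        have h₂ : (CellCx.U.map (h.K.map α)).left ≫ 𝟙 g.left = 𝟙 f.left ≫ α.left := h₁
        have h₂ : (CellCx.U.map (h.K.map α)).left = α.left :=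
          (Category.comp_id _).symm.trans (h₂.trans (Category.id_comp _))
        have h₃ := Arrow.w (CellCx.U.map (h.K.map α))
        rw [h₂] at h₃
        exact h₃ }
  p :=
    { app := fun f => freeE f
      naturality := fun f g α => congrArg Arrow.Hom.right (h.U_map_K_map α) }
  fac := by
    ext1
    funext f
    exact toBody_freeE f
  hi _ := trivial
  hp _ := trivial

/-! ### Composition of cell complexes -/

namespace StrataSeq

section AddStratum

/-! A stratum `T` is composed onto a sequence of strata `Z` whose body is identified with the
boundary of `T` by a map `q` (an isomorphism in all cases of interest). -/

variable (Z : StrataSeq.{u}) (T : Stratum.{u}) (q : Z.body ⟶ T.X)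

/-- The attaching map of the cell `t` factors through the `k`-th space of `Z`. -/
def FactorsThrough (k : ℕ) (t : T.S) : Prop :=
  ∃ g : diskBoundary.{u} (T.κ t) ⟶ Z.X k, g ≫ Z.toBody k ≫ q = T.b t

/-- The cells `t` of `T` for which `k` is the smallest number such that the attaching map
factors through the `k`-th space of `Z`. -/
def NewCell (k : ℕ) : Type u :=
  { t : T.S // IsLeast { j : ℕ | Z.FactorsThrough T q j t } k }

variable {Z T q}

/-- The factorisation of the attaching map of a cell; it is unique, since the maps from the
`k`-th space of a sequence of strata to its body are injective. -/
def NewCell.lift {k : ℕ} (t : NewCell Z T q k) : diskBoundary.{u} (T.κ t.1) ⟶ Z.X k :=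
  Exists.choose t.2.1

theorem NewCell.lift_spec {k : ℕ} (t : NewCell Z T q k) :
    t.lift ≫ Z.toBody k ≫ q = T.b t.1 :=
  Exists.choose_spec t.2.1

variable (Z T q)

/-- The `k`-th space `W` of the composite, with the maps from the `k`-th space of `Z` and to the
body of `T`. -/
structure AddStage (k : ℕ) where
  W : TopCat.{u}
  j : Z.X k ⟶ W
  v : W ⟶ T.body
  comm : j ≫ v = Z.toBody k ≫ q ≫ T.incl

variable {Z T q}

namespace AddStage

variable {k : ℕ} (D : AddStage Z T q k)

/-- The `k`-th stratum of the composite: the cells are those in the `k`-th stratum of `Z`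
together with the new cells that belong to level `k`. -/
def stratum : Stratum.{u} where
  X := D.W
  S := (Z.st k).S ⊕ NewCell Z T q k
  κ := Sum.elim (Z.st k).κ (fun t => T.κ t.1)
  b
    | Sum.inl s => (Z.st k).b s ≫ D.j
    | Sum.inr t => t.lift ≫ D.j

/-- The `k`-th stratum of `Z` maps to that of the composite. -/
def inclusion : Z.st k ⟶ D.stratum where
  f := D.j
  p := Sum.inl
  hκ _ := rfl
  hb _ := (Category.id_comp _).symm

/-- The map from the body of the `k`-th stratum of the composite to the body of `T`. -/
def bodyV : D.stratum.body ⟶ T.body :=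
  D.stratum.desc D.v
    (fun
      | Sum.inl s => (Z.st k).cell s ≫ (Z.glue k).hom ≫ Z.toBody (k + 1) ≫ q ≫ T.incl
      | Sum.inr t => T.cell t.1)
    (by
      rintro (s | t)
      · change ((Z.st k).b s ≫ D.j) ≫ D.v = diskBoundaryInclusion ((Z.st k).κ s) ≫
          (Z.st k).cell s ≫ (Z.glue k).hom ≫ Z.toBody (k + 1) ≫ q ≫ T.incl
        rw [Category.assoc, D.comm, ← Z.step_toBody k, StrataSeq.step]
        have h := (Z.st k).condition s =≫ ((Z.glue k).hom ≫ Z.toBody (k + 1) ≫ q ≫ T.incl)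
        simpa only [Category.assoc] using h
      · change (t.lift ≫ D.j) ≫ D.v = diskBoundaryInclusion (T.κ t.1) ≫ T.cell t.1
        rw [Category.assoc, D.comm, ← T.condition, ← t.lift_spec]
        simp only [Category.assoc])

theorem incl_bodyV : D.stratum.incl ≫ D.bodyV = D.v := D.stratum.incl_desc D.v _ _

/-- The next space of the composite is the body of the present stratum. -/
def next : AddStage Z T q (k + 1) where
  W := D.stratum.body
  j := (Z.glue k).inv ≫ Stratum.bodyMap D.inclusion
  v := D.bodyV
  comm := by
    rw [Category.assoc, Iso.inv_comp_eq]
    apply Stratum.body_hom_ext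
    · rw [← Category.assoc, Stratum.incl_bodyMap, Category.assoc, incl_bodyV]
      have h := Z.step_toBody k =≫ (q ≫ T.incl)
      rw [StrataSeq.step] at h
      simp only [Category.assoc] at h
      rw [h]
      exact D.comm
    · intro s
      rw [← Category.assoc, Stratum.cell_bodyMap, Category.assoc]
      refine (Category.id_comp _).trans ?_
      exact D.stratum.cell_desc D.v _ _ (Sum.inl s)

end AddStage

variable (Z T q)

/-- The spaces of the composite, starting with the boundary of `Z`. -/
def addStage : ∀ k : ℕ, AddStage Z T q k
  | 0 => { W := Z.X 0, j := 𝟙 _, v := Z.toBody 0 ≫ q ≫ T.incl, comm := Category.id_comp _ }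
  | k + 1 => (addStage k).next

/-- The composite of `Z` with the stratum `T`. -/
def addStratum : StrataSeq.{u} where
  st k := (addStage Z T q k).stratum
  connected _ := rfl

/-- The canonical morphism from `Z` to the composite. -/
def toAddStratum : Z ⟶ addStratum Z T q where
  φ k := (addStage Z T q k).inclusion
  coherent k := by
    change (Z.glue k).hom ≫ (Z.glue k).inv ≫ Stratum.bodyMap (addStage Z T q k).inclusion =
      Stratum.bodyMap (addStage Z T q k).inclusion ≫ 𝟙 _
    rw [Iso.hom_inv_id_assoc, Category.comp_id]

/-- The canonical map from the body of the composite to the body of `T`. -/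
def addStratumBody : (addStratum Z T q).body ⟶ T.body :=
  (addStratum Z T q).bodyDesc (fun k => (addStage Z T q k).v) (fun k => by
    change ((addStage Z T q k).stratum.incl ≫ 𝟙 _) ≫ (addStage Z T q k).bodyV = _
    rw [Category.comp_id]
    exact (addStage Z T q k).incl_bodyV)

end AddStratum

section Stack

variable (A B : StrataSeq.{u}) (e : A.body = B.X 0)

/-- The sequence `A` with the first `n` strata of `B` composed onto it one by one, together with
the canonical map from its body to the `n`-th space of `B`. -/
def stackAux : ∀ n : ℕ, Σ Z : StrataSeq.{u}, (Z.body ⟶ B.X n)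
  | 0 => ⟨A, eqToHom e⟩
  | n + 1 =>
    ⟨addStratum (stackAux n).1 (B.st n) (stackAux n).2,
      addStratumBody (stackAux n).1 (B.st n) (stackAux n).2 ≫ (B.glue n).hom⟩

/-- The sequence `A` with the first `n` strata of `B` composed onto it. -/
def stack (n : ℕ) : StrataSeq.{u} := (stackAux A B e n).1

/-- The canonical map from the body of `stack n` to the `n`-th space of `B`. -/
def stackBody (n : ℕ) : (stack A B e n).body ⟶ B.X n := (stackAux A B e n).2

/-- The canonical morphism from each stack to the next. -/
def stackStep (n : ℕ) : stack A B e n ⟶ stack A B e (n + 1) :=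
  toAddStratum (stack A B e n) (B.st n) (stackBody A B e n)

/-- The diagram of all stacks. -/
def stackDiagram : ℕ ⥤ StrataSeq.{u} := Functor.ofSequence (stackStep A B e)

end Stack

end StrataSeq

namespace CellCx

/-- The composite of the underlying maps of two composable cell complexes. -/
def compUnderlying (A B : CellCx.{u}) (e : A.obj.body = B.obj.X 0) : Arrow TopCat.{u} :=
  Arrow.mk (A.obj.toBody 0 ≫ eqToHom e ≫ B.obj.toBody 0)

/-- A composite `B * A` of two cell complexes such that the body of `A` is the boundary of `B`:
a colimit of the sequence of stacks which is proper (so it is also their colimit among cell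
complexes), with the canonical identification of its underlying map with the composite of the
underlying maps of `A` and `B`. -/
structure Composite (A B : CellCx.{u}) (e : A.obj.body = B.obj.X 0) where
  cocone : Cocone (StrataSeq.stackDiagram A.obj B.obj e)
  isColimit : IsColimit cocone
  proper : cocone.pt.IsProper
  iso : StrataSeq.underlying.obj cocone.pt ≅ compUnderlying A B e
  iso_left : (StrataSeq.Hom.φ (cocone.ι.app 0) 0).f ≫ iso.hom.left = 𝟙 (A.obj.X 0)
  iso_right : ∀ n, StrataSeq.bodyMap (cocone.ι.app n) ≫ iso.hom.right =
    StrataSeq.stackBody A.obj B.obj e n ≫ B.obj.toBody n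

/-- The composite as a cell complex. -/
def Composite.cx {A B : CellCx.{u}} {e : A.obj.body = B.obj.X 0} (c : Composite A B e) :
    CellCx.{u} := ⟨c.cocone.pt, c.proper⟩

end CellCx

/-- The free cell complexes on `f` and on `E f` are composable; this is the type of their
composites `K E f * K f`. -/
abbrev FreeComposite (f : Arrow TopCat.{u}) :=
  CellCx.Composite (freeCx f) (freeCx (Arrow.mk (freeE f))) rfl

/-- The morphism `(1, E E f)` from the underlying map of `K E f * K f` to `f`. -/
def FreeComposite.toArrow {f : Arrow TopCat.{u}} (c : FreeComposite f) :
    CellCx.U.obj c.cx ⟶ f :=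
  c.iso.hom ≫ Arrow.homMk (u := 𝟙 f.left) (v := freeE (Arrow.mk (freeE f))) (by
    change 𝟙 f.left ≫ f.hom = ((freeSeq f).toBody 0 ≫ 𝟙 _ ≫
      (freeSeq (Arrow.mk (freeE f))).toBody 0) ≫ freeE (Arrow.mk (freeE f))
    refine (Category.id_comp _).trans ((toBody_freeE f).symm.trans ?_)
    refine .trans ?_ (Category.assoc _ _ _).symm
    exact congrArg ((freeSeq f).toBody 0 ≫ ·) (toBody_freeE (Arrow.mk (freeE f))).symm)

/-- The map from the body of `K E f` to the body of `K f` given by composition of cell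
complexes: the body part of the morphism `K E f * K f ⟶ K f` that corresponds to `(1, E E f)`. -/
def FreeComposite.mul {f : Arrow TopCat.{u}} (h : FreeProperty.{u}) (c : FreeComposite f) :
    (freeSeq (Arrow.mk (freeE f))).body ⟶ (freeSeq f).body :=
  c.iso.inv.right ≫ (CellCx.U.map (h.equiv c.cx f c.toArrow)).right

end

noncomputable section

/-! Everything rests on one geometric fact: attaching cells leaves the old space intact. As a set,
the body of a stratum is the boundary together with the interiors of the cells, and `Stratum.incl`
is a closed embedding. A morphism of strata carries interiors to interiors, so it reflects the
boundary (`Stratum.mem_range_incl_of_bodyMap`), and a morphism of sequences of strata reflects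
factorisations through lower stages (`StrataSeq.exists_factor_of_map`).

Freeness follows. A map from the underlying map of `C` to `f` forces each cell of `C` to go to the
square made of its attaching map and its characteristic map, both pushed forward. This square is
admissible because `C` is proper and the partial lift reflects the boundary. Conversely a cell of
the free complex is nothing more than its square, so the lift is unique (`freeSeq_hom_ext`).

Composites exist because spheres are compact: an attaching map into a body factors through some
finite stage (`StrataSeq.exists_factor_of_compactSpace`), so every cell of the second complex has a
least level at which it can be attached. Redistributing cells over levels does not change the body,
colimits of sequences of strata are computed level by level, and properness survives, again by
reflection.

For the monad and the distributive law, the multiplication shifts levels in general, so it need not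
come from a morphism of complexes; but it still carries characteristic maps to characteristic maps.
Since properness recovers the level of a cell from its attaching map, such a cellular map into a
free complex is determined by its restriction to the boundary and its composite with `freeE`
(`freeSeq_isCellular_ext`). All structure maps are cellular, so each law reduces to two comparisons
that follow from naturality and the defining identities of `δ` and `μ`; `CellularData` isolates this
formal argument. -/

instance TopCat.t2Space_disk (n : ℕ) : T2Space (disk.{u} n) := by
  unfold disk; infer_instance

theorem TopCat.isClosedEmbedding_diskBoundaryInclusion (n : ℕ) :
    Topology.IsClosedEmbedding (diskBoundaryInclusion.{u} n) :=
  (diskBoundaryInclusion.{u} n).hom.continuous.isClosedEmbedding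
    ((TopCat.mono_iff_injective _).1 inferInstance)

/-- A map lifts through an embedding whose range contains its image. -/
theorem TopCat.exists_lift_of_isEmbedding {K X Y : TopCat.{u}} {i : X ⟶ Y}
    (hi : Topology.IsEmbedding i) (g : K ⟶ Y) (h : ∀ x, g x ∈ Set.range i) :
    ∃ g' : K ⟶ X, g' ≫ i = g := by
  choose l hl using h
  have hc : Continuous l := by
    rw [hi.continuous_iff]
    exact (funext hl : i ∘ l = g) ▸ g.hom.continuous
  exact ⟨TopCat.ofHom ⟨l, hc⟩, by ext x; exact hl x⟩

/-! ### Points and topology of the body of a stratum -/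

namespace Stratum

variable (P : Stratum.{u})

/-- Functions out of the body of a stratum can be defined piecewise. -/
theorem exists_fun {W : Type u} (g : P.X → W) (c : ∀ s, disk.{u} (P.κ s) → W)
    (h : ∀ s x, g (P.b s x) = c s (diskBoundaryInclusion (P.κ s) x)) :
    ∃ F : P.body → W, (∀ x, F (P.incl x) = g x) ∧ ∀ s x, F (P.cell s x) = c s x := by
  -- Every function into an indiscrete space is continuous, so the universal property of the pushout
  -- applies to bare functions.
  let g' : P.X ⟶ TopCat.trivial.obj W :=
    TopCat.ofHom (Y := TopCat.trivial.obj W) ⟨g, continuous_top⟩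
  let c' : ∀ s, disk.{u} (P.κ s) ⟶ TopCat.trivial.obj W := fun s =>
    TopCat.ofHom (Y := TopCat.trivial.obj W) ⟨c s, continuous_top⟩
  have h' : ∀ s, P.b s ≫ g' = diskBoundaryInclusion (P.κ s) ≫ c' s := fun s => by
    ext x; exact h s x
  refine ⟨P.desc g' c' h', fun x => ?_, fun s x => ?_⟩
  · exact ConcreteCategory.congr_hom (P.incl_desc g' c' h') x
  · exact ConcreteCategory.congr_hom (P.cell_desc g' c' h' s) x

/-- The indicator of the covered points and the constant `True` are both continuous into an
indiscrete space and agree on the boundary and on all cells. -/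
theorem jointly_surjective (y : P.body) :
    (∃ x, P.incl x = y) ∨ ∃ s x, P.cell s x = y := by
  let g : P.body ⟶ TopCat.trivial.obj (ULift.{u} Prop) :=
    TopCat.ofHom (Y := TopCat.trivial.obj _)
      ⟨fun y => ⟨(∃ x, P.incl x = y) ∨ ∃ s x, P.cell s x = y⟩, continuous_top⟩
  let t : P.body ⟶ TopCat.trivial.obj (ULift.{u} Prop) :=
    TopCat.ofHom (Y := TopCat.trivial.obj _) ⟨fun _ => ⟨True⟩, continuous_top⟩
  have : g = t := by
    apply P.body_hom_ext
    · ext x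
      exact congrArg ULift.up (eq_true (Or.inl ⟨x, rfl⟩))
    · intro s
      ext x
      exact congrArg ULift.up (eq_true (Or.inr ⟨s, x, rfl⟩))
  exact of_eq_true (congrArg ULift.down (ConcreteCategory.congr_hom this y))

theorem incl_b (s : P.S) (x : diskBoundary.{u} (P.κ s)) :
    P.incl (P.b s x) = P.cell s (diskBoundaryInclusion (P.κ s) x) :=
  ConcreteCategory.congr_hom (P.condition s) x

/-- Open sets are the continuous maps to the Sierpiński space `Prop`, so the universal property of
the body glues open sets of the pieces. -/
theorem isOpen_iff (U : Set P.body) :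
    IsOpen U ↔ IsOpen (P.incl ⁻¹' U) ∧ ∀ s, IsOpen (P.cell s ⁻¹' U) := by
  refine ⟨fun h => ⟨h.preimage P.incl.hom.continuous,
    fun s => h.preimage (P.cell s).hom.continuous⟩, fun ⟨h₁, h₂⟩ => ?_⟩
  let g : P.X ⟶ TopCat.of (ULift.{u} Prop) := TopCat.ofHom
    ⟨fun x => ⟨P.incl x ∈ U⟩, continuous_uliftUp.comp (continuous_Prop.2 h₁)⟩
  let c : ∀ s, disk.{u} (P.κ s) ⟶ TopCat.of (ULift.{u} Prop) := fun s => TopCat.ofHom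
    ⟨fun x => ⟨P.cell s x ∈ U⟩, continuous_uliftUp.comp (continuous_Prop.2 (h₂ s))⟩
  have h' : ∀ s, P.b s ≫ g = diskBoundaryInclusion (P.κ s) ≫ c s := fun s => by
    ext x
    exact iff_of_eq (congrArg (· ∈ U) (P.incl_b s x))
  have key : ∀ y, (P.desc g c h' y).down = (y ∈ U) := by
    intro y
    obtain ⟨x, rfl⟩ | ⟨s, x, rfl⟩ := P.jointly_surjective y
    · exact congrArg ULift.down (ConcreteCategory.congr_hom (P.incl_desc g c h') x)
    · exact congrArg ULift.down (ConcreteCategory.congr_hom (P.cell_desc g c h' s) x)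
  have hc : Continuous fun y => (P.desc g c h' y).down :=
    continuous_uliftDown.comp (P.desc g c h').hom.continuous
  have := continuous_Prop.1 hc
  simpa only [key] using! this

theorem isClosed_iff (C : Set P.body) :
    IsClosed C ↔ IsClosed (P.incl ⁻¹' C) ∧ ∀ s, IsClosed (P.cell s ⁻¹' C) := by
  simp only [← isOpen_compl_iff, P.isOpen_iff, Set.preimage_compl]

-- A normal form for points of the body: a boundary point of a disk is moved to its image under the
-- attaching map, and an interior point is kept with its cell. It separates the boundary from the
-- cell interiors and these from each other.
open Classical in
theorem exists_classify : ∃ F : P.body → P.X ⊕ Σ s : P.S, disk.{u} (P.κ s),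
    (∀ x, F (P.incl x) = Sum.inl x) ∧
    ∀ s x, x ∉ Set.range (diskBoundaryInclusion (P.κ s)) →
      F (P.cell s x) = Sum.inr ⟨s, x⟩ := by
  obtain ⟨F, h₁, h₂⟩ := P.exists_fun
    (W := P.X ⊕ Σ s : P.S, disk.{u} (P.κ s))
    (fun x => Sum.inl x)
    (fun s x => if h : x ∈ Set.range (diskBoundaryInclusion (P.κ s)) then
      Sum.inl (P.b s h.choose) else Sum.inr ⟨s, x⟩)
    (fun s x => by
      have h : diskBoundaryInclusion (P.κ s) x ∈ Set.range (diskBoundaryInclusion.{u} (P.κ s)) :=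
        ⟨x, rfl⟩
      have hx : h.choose = x :=
        (isClosedEmbedding_diskBoundaryInclusion (P.κ s)).injective h.choose_spec
      rw [dif_pos h, hx])
  exact ⟨F, h₁, fun s x hx => (h₂ s x).trans (dif_neg hx)⟩

theorem incl_injective : Function.Injective P.incl := by
  obtain ⟨F, h₁, -⟩ := P.exists_classify
  intro x y h
  have := congrArg F h
  rw [h₁, h₁] at this
  simpa using this

theorem cell_mem_range_incl_iff (s : P.S) (x : disk.{u} (P.κ s)) :
    P.cell s x ∈ Set.range P.incl ↔ x ∈ Set.range (diskBoundaryInclusion (P.κ s)) := by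
  constructor
  · rintro ⟨y, hy⟩
    by_contra hx
    obtain ⟨F, h₁, h₂⟩ := P.exists_classify
    have := congrArg F hy
    rw [h₁, h₂ s x hx] at this
    simp at this
  · rintro ⟨y, rfl⟩
    exact ⟨_, P.incl_b s y⟩

/-- The image of a closed set `C` meets a cell exactly in the part of its boundary sphere that is
attached to `C`, and the sphere is closed in the disk. -/
theorem isClosedEmbedding_incl : Topology.IsClosedEmbedding P.incl := by
  refine .of_continuous_injective_isClosedMap P.incl.hom.continuous P.incl_injective ?_
  intro C hC
  rw [P.isClosed_iff]
  refine ⟨by rwa [Set.preimage_image_eq _ P.incl_injective], fun s => ?_⟩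
  have : P.cell s ⁻¹' (P.incl '' C) = diskBoundaryInclusion (P.κ s) '' (P.b s ⁻¹' C) := by
    ext x
    constructor
    · rintro ⟨y, hy, hyx⟩
      obtain ⟨z, rfl⟩ := (P.cell_mem_range_incl_iff s x).1 ⟨y, hyx⟩
      have : y = P.b s z := P.incl_injective (hyx.trans (P.incl_b s z).symm)
      exact ⟨z, (this ▸ hy : P.b s z ∈ C), rfl⟩
    · rintro ⟨z, hz, rfl⟩
      exact ⟨_, hz, P.incl_b s z⟩
  rw [this]
  exact (isClosedEmbedding_diskBoundaryInclusion _).isClosedMap _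
    (hC.preimage (P.b s).hom.continuous)

/-- Such a point has at most one preimage in each disk and none in the boundary. As `P.X` is an
arbitrary space, its own points need not be closed. -/
theorem isClosed_singleton {y : P.body} (hy : y ∉ Set.range P.incl) : IsClosed {y} := by
  obtain hx | ⟨s, x, rfl⟩ := P.jointly_surjective y
  · exact absurd hx hy
  have hx := fun h => hy ((P.cell_mem_range_incl_iff s x).2 h)
  obtain ⟨F, -, h₂⟩ := P.exists_classify
  rw [P.isClosed_iff]
  refine ⟨?_, fun s' => ?_⟩
  · have : P.incl ⁻¹' {P.cell s x} = ∅ := by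
      ext z
      simp only [Set.mem_preimage, Set.mem_singleton_iff, Set.mem_empty_iff_false, iff_false]
      exact fun h => hy ⟨z, h⟩
    rw [this]; exact isClosed_empty
  · refine Set.Subsingleton.isClosed ?_
    have key : ∀ z : disk.{u} (P.κ s'), P.cell s' z = P.cell s x →
        (⟨s', z⟩ : Σ s : P.S, disk.{u} (P.κ s)) = ⟨s, x⟩ := by
      intro z hz
      have hz' : z ∉ Set.range (diskBoundaryInclusion (P.κ s')) := fun h =>
        hy (hz ▸ (P.cell_mem_range_incl_iff s' z).2 h)
      have := congrArg F hz
      rw [h₂ s x hx, h₂ s' z hz'] at this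
      simpa using this
    intro z hz w hw
    simpa using (key z hz).trans (key w hw).symm

theorem eqToHom_mem_range {m n : ℕ} (h : m = n) (x : disk.{u} m) :
    eqToHom (congrArg disk.{u} h) x ∈ Set.range (diskBoundaryInclusion.{u} n) ↔
      x ∈ Set.range (diskBoundaryInclusion.{u} m) := by
  subst h; rfl

variable {P}

/-- The map of bodies induced by a morphism of strata takes no point in the interior of a cell to
the boundary. -/
theorem mem_range_incl_of_bodyMap {Q : Stratum.{u}} (φ : P ⟶ Q) {y : P.body}
    (hy : bodyMap φ y ∈ Set.range Q.incl) : y ∈ Set.range P.incl := by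
  obtain hx | ⟨s, x, rfl⟩ := P.jointly_surjective y
  · exact hx
  have h := ConcreteCategory.congr_hom (cell_bodyMap φ s) x
  rw [ConcreteCategory.comp_apply, ConcreteCategory.comp_apply] at h
  rw [h, cell_mem_range_incl_iff, eqToHom_mem_range (φ.hκ s)] at hy
  exact (P.cell_mem_range_incl_iff s x).2 hy

end Stratum

/-! ### Stages of a sequence of strata, compactness, and reflection along morphisms -/

namespace StrataSeq

variable (A : StrataSeq.{u})

theorem trans_self (n : ℕ) : A.trans (le_refl n) = 𝟙 _ := A.diagram.map_id n

theorem trans_toBody {m n : ℕ} (h : m ≤ n) : A.trans h ≫ A.toBody n = A.toBody m :=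
  colimit.w A.diagram (homOfLE h)

theorem isClosedEmbedding_step (n : ℕ) : Topology.IsClosedEmbedding (A.step n) := by
  have h : ⇑(A.step n) = homeoOfIso (A.glue n) ∘ (A.st n).incl := rfl
  rw [h]
  exact (homeoOfIso (A.glue n)).isClosedEmbedding.comp (A.st n).isClosedEmbedding_incl

theorem isClosedEmbedding_trans {m n : ℕ} (h : m ≤ n) :
    Topology.IsClosedEmbedding (A.trans h) := by
  induction n, h using Nat.le_induction with
  | base =>
    rw [trans_self]
    exact .id
  | succ n h ih =>
    rw [trans_succ A h]
    exact (A.isClosedEmbedding_step n).comp ih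

theorem exists_toBody (y : A.body) : ∃ n x, A.toBody n x = y :=
  Concrete.colimit_exists_rep A.diagram y

theorem toBody_trans {m n : ℕ} (h : m ≤ n) (x : A.X m) :
    A.toBody n (A.trans h x) = A.toBody m x :=
  ConcreteCategory.congr_hom (A.trans_toBody h) x

theorem toBody_injective (n : ℕ) : Function.Injective (A.toBody n) := by
  intro x y h
  obtain ⟨k, f, g, hk⟩ := Concrete.colimit_exists_of_rep_eq A.diagram x y h
  exact (A.isClosedEmbedding_trans (leOfHom f)).injective hk

instance mono_toBody (n : ℕ) : Mono (A.toBody n) :=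
  (TopCat.mono_iff_injective _).2 (A.toBody_injective n)

theorem isClosed_iff (C : Set A.body) : IsClosed C ↔ ∀ n, IsClosed (A.toBody n ⁻¹' C) :=
  TopCat.isClosed_iff_of_isColimit _ (colimit.isColimit A.diagram) C

theorem isClosedEmbedding_toBody (n : ℕ) : Topology.IsClosedEmbedding (A.toBody n) := by
  refine .of_continuous_injective_isClosedMap (A.toBody n).hom.continuous
    (A.toBody_injective n) fun C hC => ?_
  rw [isClosed_iff]
  intro m
  have : A.toBody m ⁻¹' (A.toBody n '' C) =
      A.trans (le_max_left m n) ⁻¹' (A.trans (le_max_right m n) '' C) := by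
    ext x
    constructor
    · rintro ⟨y, hy, h⟩
      refine ⟨y, hy, A.toBody_injective (max m n) ?_⟩
      rw [toBody_trans, toBody_trans, h]
    · rintro ⟨y, hy, h⟩
      refine ⟨y, hy, ?_⟩
      rw [← A.toBody_trans (le_max_left m n) x, ← h, toBody_trans]
  rw [this]
  exact ((A.isClosedEmbedding_trans _).isClosedMap _ hC).preimage
    (A.trans (le_max_left m n)).hom.continuous

theorem range_toBody_mono {m n : ℕ} (h : m ≤ n) :
    Set.range (A.toBody m) ⊆ Set.range (A.toBody n) := by
  rintro _ ⟨x, rfl⟩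
  exact ⟨_, A.toBody_trans h x⟩

theorem mem_range_step_iff {n : ℕ} (y : (A.st n).body) :
    (A.glue n).hom y ∈ Set.range (A.step n) ↔ y ∈ Set.range (A.st n).incl := by
  constructor
  · rintro ⟨x, hx⟩
    exact ⟨x, (homeoOfIso (A.glue n)).injective hx⟩
  · rintro ⟨x, rfl⟩
    exact ⟨x, rfl⟩

/-- Away from the bottom space, a point first appears in the interior of a cell at some level; it is
closed in that body, which is closed in the whole. -/
theorem isClosed_singleton {y : A.body} (hy : y ∉ Set.range (A.toBody 0)) : IsClosed {y} := by
  obtain ⟨n, x, rfl⟩ := A.exists_toBody y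
  induction n with
  | zero => exact absurd ⟨x, rfl⟩ hy
  | succ n ih =>
    by_cases hx : x ∈ Set.range (A.step n)
    · obtain ⟨z, rfl⟩ := hx
      have h : A.toBody (n + 1) (A.step n z) = A.toBody n z :=
        ConcreteCategory.congr_hom (A.step_toBody n) z
      rw [h] at hy ⊢
      exact ih z hy
    · obtain ⟨z, rfl⟩ := (homeoOfIso (A.glue n)).surjective x
      have hz := fun h => hx ((A.mem_range_step_iff z).2 h)
      have h₁ := (homeoOfIso (A.glue n)).isClosedMap _ ((A.st n).isClosed_singleton hz)
      have h₂ := (A.isClosedEmbedding_toBody (n + 1)).isClosedMap _ h₁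
      rwa [Set.image_singleton, Set.image_singleton] at h₂

/-- A map from a compact space to the body of a sequence of strata factors through some stage. -/
theorem exists_factor_of_compactSpace {K : TopCat.{u}} [CompactSpace K] (g : K ⟶ A.body) :
    ∃ (n : ℕ) (g' : K ⟶ A.X n), g' ≫ A.toBody n = g := by
  suffices h : ∃ n, ∀ x, g x ∈ Set.range (A.toBody n) by
    obtain ⟨n, hn⟩ := h
    exact ⟨n, TopCat.exists_lift_of_isEmbedding (A.isClosedEmbedding_toBody n).isEmbedding g hn⟩
  by_contra! h
  choose x hx using h
  -- The tails of a sequence whose `k`-th term lies outside the `k`-th stage.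
  let T : ℕ → Set A.body := fun i => {y | ∃ k, i ≤ k ∧ g (x k) = y}
  -- The terms of the sequence avoid the bottom space and hence are closed points, so a set of them
  -- is closed once it meets every stage in a finite set.
  have hfin : ∀ S : Set A.body, S ⊆ T 0 → (∀ n, (S ∩ Set.range (A.toBody n)).Finite) →
      IsClosed S := by
    intro S hS hSn
    rw [A.isClosed_iff]
    intro n
    have h₁ : A.toBody n ⁻¹' S = A.toBody n ⁻¹' (S ∩ Set.range (A.toBody n)) := by
      ext z; simp
    rw [h₁]
    refine IsClosed.preimage (A.toBody n).hom.continuous ?_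
    rw [← Set.biUnion_of_singleton (S ∩ Set.range (A.toBody n))]
    refine (hSn n).isClosed_biUnion fun y hy => A.isClosed_singleton ?_
    obtain ⟨k, -, rfl⟩ := hS hy.1
    exact fun h => hx k (A.range_toBody_mono (Nat.zero_le k) h)
  have hT : ∀ i, IsClosed (T i) := fun i => by
    refine hfin _ (fun y ⟨k, _, hk⟩ => ⟨k, Nat.zero_le k, hk⟩) fun n => ?_
    refine ((Set.finite_lt_nat n).image fun k => g (x k)).subset ?_
    rintro _ ⟨⟨k, -, rfl⟩, hk⟩
    refine ⟨k, ?_, rfl⟩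
    by_contra hkn
    exact hx k (A.range_toBody_mono (not_lt.1 hkn) hk)
  -- By compactness some `z` has its image in every tail. But that image lies in some stage `n`,
  -- which the `n`-th tail avoids.
  have hne := IsCompact.nonempty_iInter_of_sequence_nonempty_isCompact_isClosed
    (fun i => g ⁻¹' T i) (fun i z ⟨k, hk, hz⟩ => ⟨k, (Nat.le_succ i).trans hk, hz⟩)
    (fun i => ⟨x i, i, le_rfl, rfl⟩)
    ((hT 0).preimage g.hom.continuous).isCompact (fun i => (hT i).preimage g.hom.continuous)
  obtain ⟨z, hz⟩ := hne
  rw [Set.mem_iInter] at hz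
  obtain ⟨n, w, hw⟩ := A.exists_toBody (g z)
  obtain ⟨k, hk, hkz⟩ := hz n
  exact hx k (A.range_toBody_mono hk ⟨w, hw.trans hkz.symm⟩)

variable {A}

theorem mem_range_step_of_map {B : StrataSeq.{u}} (φ : A ⟶ B) {n : ℕ} {y : A.X (n + 1)}
    (h : (φ.φ (n + 1)).f y ∈ Set.range (B.step n)) : y ∈ Set.range (A.step n) := by
  obtain ⟨z, rfl⟩ := (homeoOfIso (A.glue n)).surjective y
  have hc : (φ.φ (n + 1)).f ((A.glue n).hom z) = (B.glue n).hom (Stratum.bodyMap (φ.φ n) z) :=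
    ConcreteCategory.congr_hom (φ.coherent n) z
  refine (A.mem_range_step_iff z).2 (Stratum.mem_range_incl_of_bodyMap (φ.φ n) ?_)
  rw [← B.mem_range_step_iff, ← hc]
  exact h

/-- Reflection descends one step at a time: injectivity of the step of `B` identifies the image of
the descended point, so the induction hypothesis applies to it. -/
theorem mem_range_trans_of_map {B : StrataSeq.{u}} (φ : A ⟶ B) {m n : ℕ} (h : m ≤ n) {y : A.X n}
    (hy : (φ.φ n).f y ∈ Set.range (B.trans h)) : y ∈ Set.range (A.trans h) := by
  induction n, h using Nat.le_induction with
  | base => rw [trans_self]; exact ⟨y, rfl⟩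
  | succ n h ih =>
    rw [trans_succ B h] at hy
    obtain ⟨z, hz⟩ := hy
    obtain ⟨y, rfl⟩ := mem_range_step_of_map φ ⟨_, hz⟩
    have hs : (φ.φ (n + 1)).f (A.step n y) = B.step n ((φ.φ n).f y) :=
      ConcreteCategory.congr_hom (step_naturality φ n) y
    rw [hs] at hz
    obtain ⟨x, rfl⟩ := ih ⟨z, (B.isClosedEmbedding_step n).injective hz⟩
    rw [trans_succ A h]
    exact ⟨x, rfl⟩

/-- Morphisms of sequences of strata reflect factorisations through lower stages. -/
theorem exists_factor_of_map {B : StrataSeq.{u}} (φ : A ⟶ B) {m n : ℕ} (h : m ≤ n)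
    {K : TopCat.{u}} (g : K ⟶ A.X n) (g' : K ⟶ B.X m) (hg : g' ≫ B.trans h = g ≫ (φ.φ n).f) :
    ∃ g'' : K ⟶ A.X m, g'' ≫ A.trans h = g :=
  TopCat.exists_lift_of_isEmbedding (A.isClosedEmbedding_trans h).isEmbedding g fun x =>
    mem_range_trans_of_map φ h ⟨_, ConcreteCategory.congr_hom hg x⟩

end StrataSeq

/-! ### Characteristic maps and the universal property of the free cell complex -/

namespace StrataSeq

variable (A : StrataSeq.{u})

/-- The characteristic map of a cell of a sequence of strata, as a map to its body. -/
def char (n : ℕ) (s : (A.st n).S) : disk.{u} ((A.st n).κ s) ⟶ A.body :=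
  (A.st n).cell s ≫ (A.glue n).hom ≫ A.toBody (n + 1)

theorem boundary_char (n : ℕ) (s : (A.st n).S) :
    diskBoundaryInclusion ((A.st n).κ s) ≫ A.char n s = (A.st n).b s ≫ A.toBody n := by
  have h := (A.st n).condition s =≫ ((A.glue n).hom ≫ A.toBody (n + 1))
  rw [← A.step_toBody n, step]
  simpa only [char, Category.assoc] using h.symm

theorem step_hom_ext {n : ℕ} {W : TopCat.{u}} {g h : A.X (n + 1) ⟶ W}
    (h₁ : A.step n ≫ g = A.step n ≫ h)
    (h₂ : ∀ s, (A.st n).cell s ≫ (A.glue n).hom ≫ g = (A.st n).cell s ≫ (A.glue n).hom ≫ h) :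
    g = h := by
  rw [← cancel_epi (A.glue n).hom]
  refine (A.st n).body_hom_ext ?_ h₂
  simpa only [step, Category.assoc] using h₁

/-- Maps out of the body agree if they agree on the boundary and on all cells. -/
theorem body_hom_ext_char {W : TopCat.{u}} {g h : A.body ⟶ W}
    (h₀ : A.toBody 0 ≫ g = A.toBody 0 ≫ h) (H : ∀ n s, A.char n s ≫ g = A.char n s ≫ h) :
    g = h := by
  refine A.body_hom_ext fun n => ?_
  induction n with
  | zero => exact h₀
  | succ n ih =>
    refine A.step_hom_ext ?_ fun s => ?_
    · rw [← Category.assoc, ← Category.assoc, step_toBody, ih]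
    · simpa only [char, Category.assoc] using H n s

theorem char_bodyMap {A B : StrataSeq.{u}} (φ : A ⟶ B) (n : ℕ) (s : (A.st n).S) :
    A.char n s ≫ bodyMap φ =
      eqToHom (congrArg disk.{u} ((φ.φ n).hκ s)) ≫ B.char n ((φ.φ n).p s) := by
  rw [char, Category.assoc, Category.assoc, toBody_bodyMap, ← Category.assoc (A.glue n).hom,
    φ.coherent, Category.assoc, ← Category.assoc, Stratum.cell_bodyMap, Category.assoc, char]

end StrataSeq

/-- A cell of the free cell complex is determined by its level and its square. -/
theorem freeSeq_cell_ext {f : Arrow TopCat.{u}} {n : ℕ} {s t : ((freeSeq f).st n).S} {d : ℕ}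
    (hs : d = ((freeSeq f).st n).κ s) (ht : d = ((freeSeq f).st n).κ t)
    (hb : eqToHom (congrArg diskBoundary.{u} hs) ≫ ((freeSeq f).st n).b s =
      eqToHom (congrArg diskBoundary.{u} ht) ≫ ((freeSeq f).st n).b t)
    (hr : eqToHom (congrArg disk.{u} hs) ≫ s.1.2.right =
      eqToHom (congrArg disk.{u} ht) ≫ t.1.2.right) : s = t := by
  obtain ⟨⟨m, a⟩, ha⟩ := s
  obtain ⟨⟨n, b⟩, hb'⟩ := t
  obtain rfl : d = m := hs
  obtain rfl : d = n := ht
  have : a = b := Arrow.hom_ext _ _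
    ((Category.id_comp _).symm.trans (hb.trans (Category.id_comp _)))
    ((Category.id_comp _).symm.trans (hr.trans (Category.id_comp _)))
  subst this
  rfl

theorem toBody_freeE_stage (f : Arrow TopCat.{u}) (n : ℕ) :
    (freeSeq f).toBody n ≫ freeE f = (freeStage f n).e :=
  (freeSeq f).toBody_bodyDesc (fun n => (freeStage f n).e) _ n

theorem freeSeq_glue_hom (f : Arrow TopCat.{u}) (n : ℕ) : ((freeSeq f).glue n).hom = 𝟙 _ := rfl

theorem char_freeE (f : Arrow TopCat.{u}) (n : ℕ) (s : ((freeSeq f).st n).S) :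
    (freeSeq f).char n s ≫ freeE f = s.1.2.right := by
  rw [StrataSeq.char, Category.assoc, Category.assoc, toBody_freeE_stage, freeSeq_glue_hom]
  refine (congrArg (((freeSeq f).st n).cell s ≫ ·) (Category.id_comp _)).trans ?_
  exact (freeStage f n).stratum.cell_desc _ _ (fun s => Arrow.w s.1.2) s

/-- A partial lift to the free cell complex on `f` of a map from `C` to `f`. -/
structure FreeLift (C : StrataSeq.{u}) (f : Arrow TopCat.{u}) (r : C.body ⟶ f.right) (n : ℕ) where
  g : C.X n ⟶ (freeStage f n).X
  comm : g ≫ (freeStage f n).e = C.toBody n ≫ r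
  proper : ∀ s : (C.st n).S, ¬ (freeStage f n).improper ((C.st n).κ s) ((C.st n).b s ≫ g)

namespace FreeLift

variable {C : StrataSeq.{u}} {f : Arrow TopCat.{u}} {r : C.body ⟶ f.right} {n : ℕ}

/-- The morphism of strata given by a partial lift. -/
def hom (D : FreeLift C f r n) : C.st n ⟶ (freeStage f n).stratum where
  f := D.g
  -- This choice is forced: a cell of the free complex is a square, its top is dictated by
  -- compatibility with attaching maps and its bottom by the map to `f.right`.
  p s := ⟨⟨(C.st n).κ s, Arrow.homMk (u := (C.st n).b s ≫ D.g) (v := C.char n s ≫ r) (by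
    change ((C.st n).b s ≫ D.g) ≫ (freeStage f n).e =
      diskBoundaryInclusion ((C.st n).κ s) ≫ C.char n s ≫ r
    rw [Category.assoc, D.comm, ← Category.assoc, ← Category.assoc, C.boundary_char])⟩,
    D.proper s⟩
  hκ _ := rfl
  hb _ := (Category.id_comp _).symm

/-- The next partial lift; it avoids the improper attaching maps because morphisms of strata
reflect the boundary. -/
def next (hC : C.IsProper) (D : FreeLift C f r n) : FreeLift C f r (n + 1) where
  g := (C.glue n).inv ≫ Stratum.bodyMap D.hom
  comm := by
    change ((C.glue n).inv ≫ Stratum.bodyMap D.hom) ≫ (freeStage f n).stratum.desc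
      (freeStage f n).e (fun s => s.1.2.right) (fun s => Arrow.w s.1.2) = _
    rw [Category.assoc, Iso.inv_comp_eq]
    apply Stratum.body_hom_ext
    · rw [← Category.assoc, Stratum.incl_bodyMap, Category.assoc]
      have h := C.step_toBody n =≫ r
      rw [StrataSeq.step, Category.assoc, Category.assoc] at h
      rw [h]
      refine .trans (congrArg (D.g ≫ ·) ?_) D.comm
      exact (freeStage f n).stratum.incl_desc _ _ (fun s => Arrow.w s.1.2)
    · intro s
      rw [← Category.assoc, Stratum.cell_bodyMap, Category.assoc]
      refine (Category.id_comp _).trans (((freeStage f n).stratum.cell_desc _ _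
        (fun s => Arrow.w s.1.2) (D.hom.p s)).trans ?_)
      change C.char n s ≫ r = _
      rw [StrataSeq.char, Category.assoc, Category.assoc]
  proper s := by
    rintro ⟨g', hg⟩
    -- An improper image would lie in the boundary of the free stratum. By reflection the attaching
    -- map in `C` would already land in stage `n`, against the properness of `C`.
    have : ∀ x, (C.st (n + 1)).b s x ∈ Set.range (C.step n) := by
      intro x
      obtain ⟨z, hz⟩ := (homeoOfIso (C.glue n)).surjective ((C.st (n + 1)).b s x)
      rw [← hz]
      refine (C.mem_range_step_iff z).2 (Stratum.mem_range_incl_of_bodyMap D.hom ?_)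
      have hx : (freeStage f n).stratum.incl (g' x) =
          Stratum.bodyMap D.hom ((C.glue n).inv ((C.st (n + 1)).b s x)) :=
        ConcreteCategory.congr_hom hg x
      have hz' : (C.glue n).inv ((C.st (n + 1)).b s x) = z :=
        (congrArg _ hz.symm).trans ((homeoOfIso (C.glue n)).symm_apply_apply z)
      rw [hz'] at hx
      exact ⟨_, hx⟩
    obtain ⟨k, hk⟩ := TopCat.exists_lift_of_isEmbedding
      (C.isClosedEmbedding_step n).isEmbedding ((C.st (n + 1)).b s) this
    refine hC (n + 1) s n n.lt_succ_self ⟨k, ?_⟩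
    rw [← hk]
    congr 1
    exact (C.trans_succ le_rfl).trans (by rw [C.trans_self, Category.id_comp])

end FreeLift

/-- The partial lifts of a map from a cell complex to `f`. -/
def freeLift {C : StrataSeq.{u}} (hC : C.IsProper) {f : Arrow TopCat.{u}}
    (α : StrataSeq.underlying.obj C ⟶ f) : ∀ n, FreeLift C f α.right n
  | 0 => { g := α.left, comm := Arrow.w α, proper := fun _ h => h }
  | n + 1 => (freeLift hC α n).next hC

/-- The morphism to the free cell complex that corresponds to a map of arrows. -/
def freeLiftHom {C : StrataSeq.{u}} (hC : C.IsProper) {f : Arrow TopCat.{u}}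
    (α : StrataSeq.underlying.obj C ⟶ f) : C ⟶ freeSeq f where
  φ n := (freeLift hC α n).hom
  coherent n := by
    change (C.glue n).hom ≫ (C.glue n).inv ≫ Stratum.bodyMap (freeLift hC α n).hom =
      Stratum.bodyMap (freeLift hC α n).hom ≫ 𝟙 _
    rw [Iso.hom_inv_id_assoc, Category.comp_id]

theorem bodyMap_freeLiftHom {C : StrataSeq.{u}} (hC : C.IsProper) {f : Arrow TopCat.{u}}
    (α : StrataSeq.underlying.obj C ⟶ f) :
    StrataSeq.bodyMap (freeLiftHom hC α) ≫ freeE f = α.right := by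
  refine C.body_hom_ext fun n => ?_
  rw [← Category.assoc, StrataSeq.toBody_bodyMap, Category.assoc, toBody_freeE_stage]
  exact (freeLift hC α n).comm

/-- The map of spaces at a level determines the tops of the squares and the projection to `f.right`
their bottoms, hence the map of cells; by coherence these determine the map of spaces at the next
level. -/
theorem freeSeq_hom_ext {C : StrataSeq.{u}} {f : Arrow TopCat.{u}} {φ ψ : C ⟶ freeSeq f}
    (h₀ : (φ.φ 0).f = (ψ.φ 0).f)
    (h : StrataSeq.bodyMap φ ≫ freeE f = StrataSeq.bodyMap ψ ≫ freeE f) : φ = ψ := by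
  have key : ∀ n, (φ.φ n).f = (ψ.φ n).f → φ.φ n = ψ.φ n := by
    intro n hn
    refine Stratum.hom_ext hn (funext fun s => ?_)
    refine freeSeq_cell_ext ((φ.φ n).hκ s) ((ψ.φ n).hκ s) ?_ ?_
    · rw [← (φ.φ n).hb s, hn, (ψ.φ n).hb s]
    · have h₁ := C.char n s ≫= h
      rwa [← Category.assoc, ← Category.assoc, StrataSeq.char_bodyMap, StrataSeq.char_bodyMap,
        Category.assoc, Category.assoc, char_freeE, char_freeE] at h₁
  refine StrataSeq.hom_ext fun n => key n ?_
  induction n with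
  | zero => exact h₀
  | succ n ih =>
    rw [← cancel_epi (C.glue n).hom, φ.coherent, ψ.coherent, key n ih]

theorem freeProperty : FreeProperty.{u} := by
  intro C f α
  refine ⟨ObjectProperty.homMk (freeLiftHom C.property α), ?_, fun ψ hψ => ?_⟩
  · refine Arrow.hom_ext _ _ (Category.comp_id _) (bodyMap_freeLiftHom C.property α)
  · refine ObjectProperty.hom_ext _ (freeSeq_hom_ext ?_ ?_)
    · exact (Category.comp_id _).symm.trans (congrArg Arrow.Hom.left hψ)
    · exact (congrArg Arrow.Hom.right hψ).trans (bodyMap_freeLiftHom C.property α).symm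

/-! ### Composing a stratum onto a cell complex -/

namespace StrataSeq

section AddStratum

variable (Z : StrataSeq.{u}) (T : Stratum.{u}) (q : Z.body ⟶ T.X)

theorem trans_toBody_assoc {m n : ℕ} (h : m ≤ n) {K W : TopCat.{u}} (g : K ⟶ Z.X m)
    (q : Z.body ⟶ W) : (g ≫ Z.trans h) ≫ Z.toBody n ≫ q = g ≫ Z.toBody m ≫ q := by
  rw [← Z.trans_toBody h]
  simp only [Category.assoc]

/-- Composing a stratum onto a cell complex yields a cell complex. -/
theorem addStratum_isProper (hZ : Z.IsProper) : (addStratum Z T q).IsProper := by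
  rintro n (s | t) m h ⟨g, hg⟩
  -- For both kinds of cell, a factorisation in the composite comes from one in `Z`. It contradicts
  -- the properness of `Z` for an old cell and the minimality of the level for a new one.
  · obtain ⟨g', hg'⟩ := exists_factor_of_map (toAddStratum Z T q) h.le ((Z.st n).b s) g hg
    exact hZ n s m h ⟨g', hg'⟩
  · obtain ⟨g', hg'⟩ := exists_factor_of_map (toAddStratum Z T q) h.le t.lift g hg
    refine absurd (t.2.2 (show Z.FactorsThrough T q m t.1 from ⟨g', ?_⟩)) (not_le.2 h)
    refine .trans ?_ ((congrArg (· ≫ Z.toBody n ≫ q) hg').trans t.lift_spec)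
    exact (trans_toBody_assoc Z h.le g' q).symm

theorem toBody_addStratumBody (k : ℕ) :
    (addStratum Z T q).toBody k ≫ addStratumBody Z T q = (addStage Z T q k).v :=
  toBody_bodyDesc _ _ _ k

theorem bodyMap_addStratumBody :
    bodyMap (toAddStratum Z T q) ≫ addStratumBody Z T q = q ≫ T.incl := by
  refine Z.body_hom_ext fun k => ?_
  rw [← Category.assoc, toBody_bodyMap, Category.assoc, toBody_addStratumBody]
  exact (addStage Z T q k).comm

/-- The characteristic map of a new cell of the composite. -/
def newChar {k : ℕ} (t : NewCell Z T q k) : disk.{u} (T.κ t.1) ⟶ (addStratum Z T q).body :=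
  (addStratum Z T q).char k (Sum.inr t)

theorem char_inl (k : ℕ) (s : (Z.st k).S) :
    (addStratum Z T q).char k (Sum.inl s) = Z.char k s ≫ bodyMap (toAddStratum Z T q) :=
  ((char_bodyMap (toAddStratum Z T q) k s).trans (Category.id_comp _)).symm

variable {Z T q} in
theorem AddStage.cell_bodyV {k : ℕ} (D : AddStage Z T q k) (t : NewCell Z T q k) :
    D.stratum.cell (Sum.inr t) ≫ D.bodyV = T.cell t.1 :=
  D.stratum.cell_desc D.v _ _ (Sum.inr t)

theorem newChar_addStratumBody {k : ℕ} (t : NewCell Z T q k) :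
    newChar Z T q t ≫ addStratumBody Z T q = T.cell t.1 := by
  refine (Category.assoc _ _ _).trans ?_
  refine (congrArg ((addStage Z T q k).stratum.cell (Sum.inr t) ≫ ·)
    ((Category.assoc _ _ _).trans (Category.id_comp _))).trans ?_
  refine (congrArg ((addStage Z T q k).stratum.cell (Sum.inr t) ≫ ·)
    (toBody_addStratumBody Z T q (k + 1))).trans ?_
  exact (addStage Z T q k).cell_bodyV t

theorem boundary_newChar {k : ℕ} (t : NewCell Z T q k) :
    diskBoundaryInclusion (T.κ t.1) ≫ newChar Z T q t =
      (t.lift ≫ Z.toBody k) ≫ bodyMap (toAddStratum Z T q) := by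
  refine ((addStratum Z T q).boundary_char k (Sum.inr t)).trans ?_
  rw [Category.assoc, toBody_bodyMap]
  exact Category.assoc _ _ _

/-- The level of a new cell is part of its type, but least elements are unique, so any occurrence of
a cell can be compared with the chosen one, `newCell`. -/
theorem newChar_eq {k k' : ℕ} (t : NewCell Z T q k) (t' : NewCell Z T q k') (h : t.1 = t'.1) :
    newChar Z T q t = eqToHom (congrArg (fun s => disk.{u} (T.κ s)) h) ≫ newChar Z T q t' := by
  obtain ⟨t, ht⟩ := t
  obtain ⟨t', ht'⟩ := t'
  obtain rfl : t = t' := h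
  obtain rfl : k = k' := ht.unique ht'
  exact (Category.id_comp _).symm

variable [IsIso q]

/-- Compactness of the sphere makes the set of levels nonempty, which rules out the default value
`0` of `sInf` on the empty set. -/
theorem isLeast_sInf_factorsThrough (t : T.S) :
    IsLeast { j : ℕ | Z.FactorsThrough T q j t } (sInf { j : ℕ | Z.FactorsThrough T q j t }) := by
  obtain ⟨n, g, hg⟩ := Z.exists_factor_of_compactSpace (T.b t ≫ inv q)
  have hne : { j : ℕ | Z.FactorsThrough T q j t }.Nonempty :=
    ⟨n, g, by rw [← Category.assoc, hg, Category.assoc, IsIso.inv_hom_id, Category.comp_id]⟩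
  exact ⟨Nat.sInf_mem hne, fun _ hj => Nat.sInf_le hj⟩

/-- The new cell of the composite that corresponds to a cell of the stratum. -/
def newCell (t : T.S) : NewCell Z T q (sInf { j : ℕ | Z.FactorsThrough T q j t }) :=
  ⟨t, isLeast_sInf_factorsThrough Z T q t⟩

/-- The inverse of the canonical map from the body of the composite to the body of the stratum. -/
def addStratumBodyInv : T.body ⟶ (addStratum Z T q).body :=
  T.desc (inv q ≫ bodyMap (toAddStratum Z T q)) (fun t => newChar Z T q (newCell Z T q t))
    (fun t => by
      have h := (newCell Z T q t).lift_spec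
      refine .trans ?_ (boundary_newChar Z T q (newCell Z T q t)).symm
      rw [← Category.assoc]
      congr 1
      rw [← Category.assoc, ← IsIso.eq_comp_inv] at h
      exact h.symm)

/-- Every cell of `T` is attached at exactly one level, along a lift of its original attaching map,
so the same cells are glued and only the order changes. -/
instance isIso_addStratumBody : IsIso (addStratumBody Z T q) := by
  have hincl : T.incl ≫ addStratumBodyInv Z T q = inv q ≫ bodyMap (toAddStratum Z T q) :=
    T.incl_desc _ _ _
  have hcell : ∀ t, T.cell t ≫ addStratumBodyInv Z T q = newChar Z T q (newCell Z T q t) :=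
    fun t => T.cell_desc _ _ _ t
  -- The round trip fixes every map that comes from the body of `Z`; this covers the bottom space
  -- and all old cells.
  have hfix : ∀ {K : TopCat.{u}} (a : K ⟶ Z.body) (c : K ⟶ (addStratum Z T q).body),
      c = a ≫ bodyMap (toAddStratum Z T q) →
      c ≫ addStratumBody Z T q ≫ addStratumBodyInv Z T q = c ≫ 𝟙 _ := by
    rintro K a _ rfl
    rw [← Category.assoc _ (addStratumBody Z T q), Category.assoc a, bodyMap_addStratumBody,
      Category.assoc, Category.assoc, hincl, IsIso.hom_inv_id_assoc, Category.comp_id]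
  refine ⟨addStratumBodyInv Z T q, ?_, ?_⟩
  · refine body_hom_ext_char _ ?_ ?_
    · exact hfix (Z.toBody 0) _
        ((toBody_bodyMap (toAddStratum Z T q) 0).trans (Category.id_comp _)).symm
    · rintro n (s | t)
      · exact hfix _ _ (char_inl Z T q n s)
      · refine .trans ?_ (Category.comp_id _).symm
        change newChar Z T q t ≫ _ = newChar Z T q t
        rw [← Category.assoc, newChar_addStratumBody, hcell,
          newChar_eq Z T q (newCell Z T q t.1) t rfl]
        exact Category.id_comp _
  · refine T.body_hom_ext ?_ fun t => ?_
    · rw [← Category.assoc, hincl, Category.assoc, bodyMap_addStratumBody,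
        IsIso.inv_hom_id_assoc, Category.comp_id]
    · rw [← Category.assoc, hcell, Category.comp_id]
      exact newChar_addStratumBody Z T q (newCell Z T q t)

end AddStratum

section Stack

variable (A B : StrataSeq.{u}) (e : A.body = B.X 0)

theorem stack_isProper (hA : A.IsProper) (n : ℕ) : (stack A B e n).IsProper := by
  induction n with
  | zero => exact hA
  | succ n ih => exact addStratum_isProper _ _ _ ih

instance isIso_stackBody (n : ℕ) : IsIso (stackBody A B e n) := by
  induction n with
  | zero => exact inferInstanceAs (IsIso (eqToHom e))
  | succ n ih =>
    exact inferInstanceAs (IsIso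
      (addStratumBody (stack A B e n) (B.st n) (stackBody A B e n) ≫ (B.glue n).hom))

theorem bodyMap_stackStep (n : ℕ) :
    bodyMap (stackStep A B e n) ≫ stackBody A B e (n + 1) = stackBody A B e n ≫ B.step n := by
  have h := bodyMap_addStratumBody (stack A B e n) (B.st n) (stackBody A B e n) =≫ (B.glue n).hom
  rw [Category.assoc, Category.assoc] at h
  exact h

theorem stackDiagram_map_succ (n : ℕ) :
    (stackDiagram A B e).map (homOfLE (n.le_add_right 1)) = stackStep A B e n :=
  Functor.ofSequence_map_homOfLE_succ (stackStep A B e) n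

end Stack

end StrataSeq

/-- The dimension of a cell in a colimit is itself defined on a quotient. Pairing it with the map
lets both descend together, and this gives the compatibility required. -/
theorem sigma_hom_ext {G : ℕ → TopCat.{u}} {W : TopCat.{u}} {m n : ℕ} {a : G m ⟶ W}
    {b : G n ⟶ W} (h : m = n) (hab : a = eqToHom (congrArg G h) ≫ b) :
    (⟨m, a⟩ : Σ n, (G n ⟶ W)) = ⟨n, b⟩ := by
  subst h
  rw [hab]
  simp

namespace StrataSeq

/-! ### Colimits of sequences of strata -/

section Colimit

variable {J : Type} [SmallCategory J] (F : J ⥤ StrataSeq.{u})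

/-- A colimit of the `k`-th spaces of a diagram of sequences of strata. -/
structure SpaceColimit (k : ℕ) where
  W : TopCat.{u}
  ι : ∀ j, (F.obj j).X k ⟶ W
  w : ∀ {i j : J} (f : i ⟶ j), ((F.map f).φ k).f ≫ ι j = ι i
  desc : ∀ {T : TopCat.{u}} (g : ∀ j, (F.obj j).X k ⟶ T),
    (∀ (i j : J) (f : i ⟶ j), ((F.map f).φ k).f ≫ g j = g i) → (W ⟶ T)
  fac : ∀ {T : TopCat.{u}} (g : ∀ j, (F.obj j).X k ⟶ T)
    (hg : ∀ (i j : J) (f : i ⟶ j), ((F.map f).φ k).f ≫ g j = g i) (j : J),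
    ι j ≫ desc g hg = g j
  hom_ext : ∀ {T : TopCat.{u}} {g h : W ⟶ T}, (∀ j, ι j ≫ g = ι j ≫ h) → g = h

/-- The functor taking a sequence of strata to its boundary. -/
def boundaryFunctor : StrataSeq.{u} ⥤ TopCat.{u} where
  obj A := A.X 0
  map f := (f.φ 0).f

/-- The colimit of the boundaries. -/
def boundaryColimit : SpaceColimit F 0 where
  W := colimit (F ⋙ boundaryFunctor)
  ι := colimit.ι (F ⋙ boundaryFunctor)
  w f := colimit.w (F ⋙ boundaryFunctor) f
  desc {T} g hg := colimit.desc (F ⋙ boundaryFunctor)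
    ⟨T, { app := g, naturality := fun _ _ f => (hg _ _ f).trans (Category.comp_id _).symm }⟩
  fac _ _ j := colimit.ι_desc _ j
  hom_ext h := colimit.hom_ext h

/-- The colimit of the sets of cells in the `k`-th strata. -/
def ColimCell (k : ℕ) : Type u :=
  Quot fun (a b : Σ j : J, ((F.obj j).st k).S) =>
    ∃ f : a.1 ⟶ b.1, ((F.map f).φ k).p a.2 = b.2

namespace ColimCell

variable {F} {k : ℕ}

/-- The class of a cell in the colimit. -/
def mk (j : J) (s : ((F.obj j).st k).S) : ColimCell F k := Quot.mk _ ⟨j, s⟩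

theorem mk_map {i j : J} (f : i ⟶ j) (s : ((F.obj i).st k).S) :
    mk j (((F.map f).φ k).p s) = mk i s :=
  (Quot.sound ⟨f, rfl⟩).symm

theorem ind {P : ColimCell F k → Prop} (h : ∀ j s, P (mk j s)) (x : ColimCell F k) : P x :=
  Quot.ind (fun a => h a.1 a.2) x

/-- Functions out of the colimit of the sets of cells. -/
def lift {α : Type v} (g : ∀ j, ((F.obj j).st k).S → α)
    (hg : ∀ (i j : J) (f : i ⟶ j) (s : ((F.obj i).st k).S), g i s = g j (((F.map f).φ k).p s)) :
    ColimCell F k → α :=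
  Quot.lift (fun a => g a.1 a.2) (by
    rintro a b ⟨f, h⟩
    exact (hg _ _ f a.2).trans (congrArg (g b.1) h))

end ColimCell

namespace SpaceColimit

variable {F} {k : ℕ} (D : SpaceColimit F k)

/-- The attaching map of a cell of the colimit, with its dimension. -/
def attach : ColimCell F k → Σ n, (diskBoundary.{u} n ⟶ D.W) :=
  ColimCell.lift (fun j s => ⟨_, ((F.obj j).st k).b s ≫ D.ι j⟩) (fun i j f s => by
    refine sigma_hom_ext (((F.map f).φ k).hκ s) ?_
    rw [← Category.assoc, ← ((F.map f).φ k).hb s, Category.assoc, D.w])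

/-- The colimit of the `k`-th strata. -/
abbrev stratum : Stratum.{u} where
  X := D.W
  S := ColimCell F k
  κ s := (D.attach s).1
  b s := (D.attach s).2

/-- The canonical morphisms to the colimit of the `k`-th strata. -/
abbrev toStratum (j : J) : (F.obj j).st k ⟶ D.stratum where
  f := D.ι j
  p := ColimCell.mk j
  hκ _ := rfl
  hb _ := (Category.id_comp _).symm

theorem map_toStratum {i j : J} (f : i ⟶ j) :
    (F.map f).φ k ≫ D.toStratum j = D.toStratum i :=
  Stratum.hom_ext (D.w f) (funext fun s => ColimCell.mk_map f s)

theorem cell_bodyMap_toStratum (j : J) (s : ((F.obj j).st k).S) :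
    ((F.obj j).st k).cell s ≫ Stratum.bodyMap (D.toStratum j) =
      D.stratum.cell (ColimCell.mk j s) :=
  (Stratum.cell_bodyMap (D.toStratum j) s).trans (Category.id_comp _)

variable {T : TopCat.{u}} (g : ∀ j, (F.obj j).X (k + 1) ⟶ T)
    (hg : ∀ (i j : J) (f : i ⟶ j), ((F.map f).φ (k + 1)).f ≫ g j = g i)

/-- The maps out of the cells of the colimit given by maps out of the next spaces. -/
def cellDesc : ColimCell F k → Σ n, (disk.{u} n ⟶ T) :=
  ColimCell.lift (fun j s => ⟨_, ((F.obj j).st k).cell s ≫ ((F.obj j).glue k).hom ≫ g j⟩)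
    (fun i j f s => by
      refine sigma_hom_ext (((F.map f).φ k).hκ s) ?_
      rw [← hg i j f, ← Category.assoc ((F.obj i).glue k).hom, (F.map f).coherent, Category.assoc,
        ← Category.assoc, Stratum.cell_bodyMap, Category.assoc])

theorem cellDesc_fst (s : ColimCell F k) : D.stratum.κ s = (cellDesc g hg s).1 := by
  induction s using ColimCell.ind with
  | h j s => rfl

/-- The map out of the body of the colimit of the `k`-th strata given by maps out of the next
spaces. -/
def bodyDesc : D.stratum.body ⟶ T :=
  D.stratum.desc (D.desc (fun j => (F.obj j).step k ≫ g j) (fun i j f => by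
      rw [← Category.assoc, ← step_naturality, Category.assoc, hg]))
    (fun s => eqToHom (congrArg disk.{u} (D.cellDesc_fst g hg s)) ≫ (cellDesc g hg s).2)
    (fun s => by
      induction s using ColimCell.ind with
      | h j s =>
        refine (Category.assoc _ _ _).trans ?_
        refine .trans ?_ (congrArg (_ ≫ ·) (Category.id_comp _).symm)
        refine (congrArg (((F.obj j).st k).b s ≫ ·) (D.fac _ _ j)).trans ?_
        have h := ((F.obj j).st k).condition s =≫ (((F.obj j).glue k).hom ≫ g j)
        rw [Category.assoc, Category.assoc] at h
        refine .trans ?_ h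
        rw [step, Category.assoc])

theorem bodyMap_bodyDesc (j : J) :
    Stratum.bodyMap (D.toStratum j) ≫ D.bodyDesc g hg = ((F.obj j).glue k).hom ≫ g j := by
  refine ((F.obj j).st k).body_hom_ext ?_ fun s => ?_
  · rw [← Category.assoc, Stratum.incl_bodyMap, Category.assoc, bodyDesc, Stratum.incl_desc,
      D.fac, step, Category.assoc]
  · rw [← Category.assoc, cell_bodyMap_toStratum]
    exact (D.stratum.cell_desc _ _ _ (ColimCell.mk j s)).trans (Category.id_comp _)

theorem stratum_body_hom_ext {g h : D.stratum.body ⟶ T}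
    (H : ∀ j, Stratum.bodyMap (D.toStratum j) ≫ g = Stratum.bodyMap (D.toStratum j) ≫ h) :
    g = h := by
  refine D.stratum.body_hom_ext (D.hom_ext fun j => ?_) fun s => ?_
  · have := ((F.obj j).st k).incl ≫= H j
    rwa [← Category.assoc, ← Category.assoc, Stratum.incl_bodyMap, Category.assoc,
      Category.assoc] at this
  · induction s using ColimCell.ind with
    | h j s =>
      have := ((F.obj j).st k).cell s ≫= H j
      rw [← Category.assoc, ← Category.assoc, cell_bodyMap_toStratum] at this
      exact this

/-- The colimit of the next spaces is the body of the colimit of the `k`-th strata. -/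
def next : SpaceColimit F (k + 1) where
  -- Taking the body itself, rather than some isomorphic colimit, makes consecutive strata of
  -- `colim` connected by definition.
  W := D.stratum.body
  ι j := ((F.obj j).glue k).inv ≫ Stratum.bodyMap (D.toStratum j)
  w {i j} f := by
    rw [Iso.eq_inv_comp, ← Category.assoc, (F.map f).coherent, Category.assoc,
      Iso.hom_inv_id_assoc, ← Stratum.bodyMap_comp, map_toStratum]
  desc g hg := D.bodyDesc g hg
  fac g hg j := by rw [Category.assoc, bodyMap_bodyDesc, Iso.inv_hom_id_assoc]
  hom_ext H := D.stratum_body_hom_ext fun j => by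
    have := H j
    rwa [Category.assoc, Category.assoc, cancel_epi] at this

end SpaceColimit

/-- The colimits of the `k`-th spaces, each built from the previous one. -/
def spaceColimit : ∀ k : ℕ, SpaceColimit F k
  | 0 => boundaryColimit F
  | k + 1 => (spaceColimit k).next

/-- The colimit of a diagram of sequences of strata. -/
abbrev colim : StrataSeq.{u} where
  st k := (spaceColimit F k).stratum
  connected _ := rfl

/-- The canonical morphisms to the colimit. -/
abbrev toColim (j : J) : F.obj j ⟶ colim F where
  φ k := (spaceColimit F k).toStratum j
  coherent _ := (Iso.hom_inv_id_assoc _ _).trans (Category.comp_id _).symm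

theorem map_toColim {i j : J} (f : i ⟶ j) : F.map f ≫ toColim F j = toColim F i :=
  hom_ext fun k => (spaceColimit F k).map_toStratum f

/-- The canonical cocone on a diagram of sequences of strata. -/
def colimCocone : Cocone F where
  pt := colim F
  ι :=
    { app := toColim F
      naturality := fun _ _ f => (map_toColim F f).trans (Category.comp_id _).symm }

section Desc

variable {Y : StrataSeq.{u}} (g : ∀ j, F.obj j ⟶ Y)
  (hg : ∀ (i j : J) (f : i ⟶ j), F.map f ≫ g j = g i)

/-- The morphism of strata out of the colimit given by a cocone. -/
def colimDescStratum (k : ℕ) : (colim F).st k ⟶ Y.st k where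
  f := (spaceColimit F k).desc (fun j => ((g j).φ k).f) (fun i j f => by
    rw [← hg i j f, comp_φ, Stratum.comp_f])
  p := ColimCell.lift (fun j s => ((g j).φ k).p s) (fun i j f s => by
    rw [← hg i j f, comp_φ, Stratum.comp_p])
  hκ s := by
    induction s using ColimCell.ind with
    | h j s => exact ((g j).φ k).hκ s
  hb s := by
    induction s using ColimCell.ind with
    | h j s =>
      refine .trans ?_ (((g j).φ k).hb s)
      refine (Category.assoc _ _ _).trans (congrArg (((F.obj j).st k).b s ≫ ·) ?_)
      exact (spaceColimit F k).fac _ _ j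

theorem toStratum_colimDescStratum (k : ℕ) (j : J) :
    (spaceColimit F k).toStratum j ≫ colimDescStratum F g hg k = (g j).φ k :=
  Stratum.hom_ext ((spaceColimit F k).fac _ _ j) rfl

/-- The morphism out of the colimit given by a cocone. -/
def colimDesc : colim F ⟶ Y where
  φ := colimDescStratum F g hg
  coherent k := by
    refine (Category.id_comp _).trans ((spaceColimit F k).stratum_body_hom_ext fun j => ?_)
    rw [← Category.assoc, ← Stratum.bodyMap_comp, toStratum_colimDescStratum, ← (g j).coherent]
    rw [← toStratum_colimDescStratum F g hg (k + 1) j, Stratum.comp_f]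
    rw [← Category.assoc ((F.obj j).glue k).hom]
    exact congrArg (· ≫ (colimDescStratum F g hg (k + 1)).f)
      (Iso.hom_inv_id_assoc ((F.obj j).glue k)
        (Stratum.bodyMap ((spaceColimit F k).toStratum j))).symm

end Desc

theorem colim_hom_ext {Y : StrataSeq.{u}} {φ ψ : colim F ⟶ Y}
    (h : ∀ j, toColim F j ≫ φ = toColim F j ≫ ψ) : φ = ψ := by
  have h' : ∀ j k, (spaceColimit F k).toStratum j ≫ φ.φ k =
      (spaceColimit F k).toStratum j ≫ ψ.φ k := fun j k =>
    congrArg (fun φ : F.obj j ⟶ Y => φ.φ k) (h j)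
  refine hom_ext fun k => Stratum.hom_ext ((spaceColimit F k).hom_ext fun j => ?_) (funext ?_)
  · exact congrArg Stratum.Hom.f (h' j k)
  · intro s
    induction s using ColimCell.ind with
    | h j s => exact congrArg (fun φ : (F.obj j).st k ⟶ Y.st k => φ.p s) (h' j k)

/-- The canonical cocone is a colimit. -/
def isColimitColimCocone : IsColimit (colimCocone F) where
  desc t := colimDesc F t.ι.app (fun _ _ f => t.w f)
  fac t j := hom_ext fun k => toStratum_colimDescStratum F t.ι.app (fun _ _ f => t.w f) k j
  uniq t _ hm := colim_hom_ext F fun j => (hm j).trans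
    (hom_ext fun k => toStratum_colimDescStratum F t.ι.app (fun _ _ f => t.w f) k j).symm

/-- The map out of the body of the colimit given by maps out of the bodies. -/
def colimBodyDesc {T : TopCat.{u}} (g : ∀ j, (F.obj j).body ⟶ T)
    (hg : ∀ (i j : J) (f : i ⟶ j), bodyMap (F.map f) ≫ g j = g i) : (colim F).body ⟶ T :=
  (colim F).bodyDesc
    (fun k => (spaceColimit F k).desc (fun j => (F.obj j).toBody k ≫ g j) (fun i j f => by
      rw [← Category.assoc, ← toBody_bodyMap, Category.assoc, hg]))
    (fun k => (spaceColimit F k).hom_ext fun j => by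
      rw [(spaceColimit F k).fac, ← Category.assoc]
      have h := step_naturality (toColim F j) k
      refine (congrArg (· ≫ _) h.symm).trans ((Category.assoc _ _ _).trans ?_)
      refine (congrArg ((F.obj j).step k ≫ ·) ((spaceColimit F (k + 1)).fac _ _ j)).trans ?_
      rw [← Category.assoc, step_toBody])

theorem bodyMap_colimBodyDesc {T : TopCat.{u}} (g : ∀ j, (F.obj j).body ⟶ T)
    (hg : ∀ (i j : J) (f : i ⟶ j), bodyMap (F.map f) ≫ g j = g i) (j : J) :
    bodyMap (toColim F j) ≫ colimBodyDesc F g hg = g j := by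
  refine (F.obj j).body_hom_ext fun k => ?_
  rw [← Category.assoc, toBody_bodyMap, Category.assoc, colimBodyDesc, toBody_bodyDesc]
  exact (spaceColimit F k).fac _ _ j

theorem colim_body_hom_ext {T : TopCat.{u}} {g h : (colim F).body ⟶ T}
    (H : ∀ j, bodyMap (toColim F j) ≫ g = bodyMap (toColim F j) ≫ h) : g = h := by
  refine (colim F).body_hom_ext fun k => (spaceColimit F k).hom_ext fun j => ?_
  have := (F.obj j).toBody k ≫= H j
  rwa [← Category.assoc, ← Category.assoc, toBody_bodyMap, Category.assoc, Category.assoc] at this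

/-- Every cell of the colimit is represented in some `F.obj j`, and the morphism from there reflects
an improper factorisation. -/
theorem colim_isProper (hF : ∀ j, (F.obj j).IsProper) : (colim F).IsProper := by
  intro n s m h
  induction s using ColimCell.ind with
  | h j s =>
    rintro ⟨g, hg⟩
    obtain ⟨g', hg'⟩ := exists_factor_of_map (toColim F j) h.le (((F.obj j).st n).b s) g hg
    exact hF j n s m h ⟨g', hg'⟩

end Colimit

/-! ### Boundary and body of the colimit of the stacks -/

section Stack

variable (A B : StrataSeq.{u}) (e : A.body = B.X 0)

/-- The canonical morphism from a stack to a later one. -/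
def stackTrans {m n : ℕ} (h : m ≤ n) : stack A B e m ⟶ stack A B e n :=
  (stackDiagram A B e).map (homOfLE h)

theorem stackTrans_self (n : ℕ) : stackTrans A B e (le_refl n) = 𝟙 _ :=
  (stackDiagram A B e).map_id n

theorem stackTrans_succ {m n : ℕ} (h : m ≤ n) :
    stackTrans A B e (h.trans n.le_succ) = stackTrans A B e h ≫ stackStep A B e n := by
  rw [← stackDiagram_map_succ]
  exact (stackDiagram A B e).map_comp (homOfLE h) (homOfLE (n.le_add_right 1))

theorem bodyMap_stackTrans {m n : ℕ} (h : m ≤ n) :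
    bodyMap (stackTrans A B e h) ≫ stackBody A B e n ≫ B.toBody n =
      stackBody A B e m ≫ B.toBody m := by
  induction n, h using Nat.le_induction with
  | base => rw [stackTrans_self, bodyMap_id, Category.id_comp]
  | succ n h ih =>
    rw [stackTrans_succ A B e h, bodyMap_comp, Category.assoc, ← ih, ← B.step_toBody n,
      ← Category.assoc (stackBody A B e n), ← bodyMap_stackStep, Category.assoc]

theorem isIso_stackTrans {m n : ℕ} (h : m ≤ n) : IsIso ((stackTrans A B e h).φ 0).f := by
  induction n, h using Nat.le_induction with
  | base =>
    rw [stackTrans_self]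
    exact inferInstanceAs (IsIso (𝟙 _))
  | succ n h ih =>
    have : IsIso ((stackStep A B e n).φ 0).f := inferInstanceAs (IsIso (𝟙 _))
    rw [stackTrans_succ A B e h, comp_φ, Stratum.comp_f]
    infer_instance

/-- The boundary of the composite is the boundary of the first complex. -/
instance isIso_toColim_stack : IsIso ((toColim (stackDiagram A B e) 0).φ 0).f := by
  have : ∀ (i j : ℕ) (f : i ⟶ j),
      IsIso ((stackDiagram A B e ⋙ boundaryFunctor).map f) := fun i j f =>
    isIso_stackTrans A B e (leOfHom f)
  -- All transition maps between the boundaries are isomorphisms, so their colimit is the value at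
  -- the initial object.
  have h : IsInitial (0 : ℕ) := IsInitial.ofUniqueHom (fun n => homOfLE n.zero_le)
    (fun _ _ => rfl)
  exact isIso_ι_of_isInitial h (stackDiagram A B e ⋙ boundaryFunctor)

/-- The canonical morphism from a stack to the colimit of all stacks. -/
def toStackColim (n : ℕ) : stack A B e n ⟶ colim (stackDiagram A B e) :=
  toColim (stackDiagram A B e) n

theorem stackStep_toStackColim (n : ℕ) :
    stackStep A B e n ≫ toStackColim A B e (n + 1) = toStackColim A B e n := by
  rw [← stackDiagram_map_succ]
  exact map_toColim (stackDiagram A B e) (homOfLE (n.le_add_right 1))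

/-- The canonical map from the body of the composite to the body of the second complex. -/
def stackColimBody : (colim (stackDiagram A B e)).body ⟶ B.body :=
  colimBodyDesc (stackDiagram A B e) (fun n => stackBody A B e n ≫ B.toBody n)
    (fun _ _ f => bodyMap_stackTrans A B e (leOfHom f))

theorem bodyMap_stackColimBody (n : ℕ) :
    bodyMap (toStackColim A B e n) ≫ stackColimBody A B e = stackBody A B e n ≫ B.toBody n :=
  bodyMap_colimBodyDesc (stackDiagram A B e) _ _ n

/-- The inverse of the canonical map between the bodies. -/
def stackColimBodyInv : B.body ⟶ (colim (stackDiagram A B e)).body :=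
  B.bodyDesc (fun n => inv (stackBody A B e n) ≫ bodyMap (toStackColim A B e n)) (fun n => by
    rw [← cancel_epi (stackBody A B e n), IsIso.hom_inv_id_assoc, ← Category.assoc,
      ← bodyMap_stackStep, Category.assoc, IsIso.hom_inv_id_assoc, ← bodyMap_comp,
      stackStep_toStackColim])

theorem toBody_stackColimBodyInv (n : ℕ) : B.toBody n ≫ stackColimBodyInv A B e =
    inv (stackBody A B e n) ≫ bodyMap (toStackColim A B e n) :=
  toBody_bodyDesc _ _ _ n

/-- The body of the composite is the body of the second complex. -/
def stackColimBodyIso : (colim (stackDiagram A B e)).body ≅ B.body where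
  hom := stackColimBody A B e
  inv := stackColimBodyInv A B e
  hom_inv_id := by
    refine colim_body_hom_ext _ fun n => ?_
    change bodyMap (toStackColim A B e n) ≫ _ = bodyMap (toStackColim A B e n) ≫ _
    rw [← Category.assoc, bodyMap_stackColimBody, Category.assoc, toBody_stackColimBodyInv,
      IsIso.hom_inv_id_assoc, Category.comp_id]
  inv_hom_id := by
    refine B.body_hom_ext fun n => ?_
    rw [← Category.assoc, toBody_stackColimBodyInv, Category.assoc, bodyMap_stackColimBody,
      IsIso.inv_hom_id_assoc, Category.comp_id]

end Stack

end StrataSeq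

/-- Composites of cell complexes exist. -/
theorem CellCx.nonempty_composite (A B : CellCx.{u}) (e : A.obj.body = B.obj.X 0) :
    Nonempty (CellCx.Composite A B e) := by
  have hw : ((StrataSeq.toStackColim A.obj B.obj e 0).φ 0).f ≫
      (StrataSeq.colim (StrataSeq.stackDiagram A.obj B.obj e)).toBody 0 ≫
        StrataSeq.stackColimBody A.obj B.obj e =
      A.obj.toBody 0 ≫ eqToHom e ≫ B.obj.toBody 0 := by
    rw [← Category.assoc, ← StrataSeq.toBody_bodyMap, Category.assoc,
      StrataSeq.bodyMap_stackColimBody]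
    rfl
  have hi : IsIso ((StrataSeq.toStackColim A.obj B.obj e 0).φ 0).f :=
    StrataSeq.isIso_toColim_stack A.obj B.obj e
  exact ⟨{
    cocone := StrataSeq.colimCocone (StrataSeq.stackDiagram A.obj B.obj e)
    isColimit := StrataSeq.isColimitColimCocone _
    proper := StrataSeq.colim_isProper _ (StrataSeq.stack_isProper A.obj B.obj e A.property)
    iso := Arrow.isoMk (asIso ((StrataSeq.toStackColim A.obj B.obj e 0).φ 0).f).symm
      (StrataSeq.stackColimBodyIso A.obj B.obj e)
      ((IsIso.inv_comp_eq ((StrataSeq.toStackColim A.obj B.obj e 0).φ 0).f).2 hw.symm)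
    iso_left := IsIso.hom_inv_id ((StrataSeq.toStackColim A.obj B.obj e 0).φ 0).f
    iso_right := StrataSeq.bodyMap_stackColimBody A.obj B.obj e }⟩

/-! ### The formal passage from cellular maps to an algebraic weak factorisation system -/

namespace FunctorialFactorisation

variable {C : Type v} [Category.{w} C] (F : FunctorialFactorisation C)

/-- The first factor of an arrow. -/
abbrev fst (f : Arrow C) : f.left ⟶ F.Z.obj f := F.i.app f

/-- The second factor of an arrow. -/
abbrev snd (f : Arrow C) : F.Z.obj f ⟶ f.right := F.p.app f

theorem fst_map {f g : Arrow C} (α : f ⟶ g) : F.fst f ≫ F.Z.map α = α.left ≫ F.fst g :=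
  (F.i.naturality α).symm

theorem map_snd {f g : Arrow C} (α : f ⟶ g) : F.Z.map α ≫ F.snd g = F.snd f ≫ α.right :=
  F.p.naturality α

theorem fst_snd (f : Arrow C) : F.fst f ≫ F.snd f = f.hom := F.fac_app

/-- The left functor on squares. -/
abbrev fstSq {f g : Arrow C} (α : f ⟶ g) : Arrow.mk (F.fst f) ⟶ Arrow.mk (F.fst g) :=
  Arrow.homMk (u := α.left) (v := F.Z.map α) (F.fst_map α).symm

/-- The right functor on squares. -/
abbrev sndSq {f g : Arrow C} (α : f ⟶ g) : Arrow.mk (F.snd f) ⟶ Arrow.mk (F.snd g) :=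
  Arrow.homMk (u := F.Z.map α) (v := α.right) (F.map_snd α)

/-- The counit of the left functor as a square. -/
abbrev counitSq (f : Arrow C) : Arrow.mk (F.fst f) ⟶ f :=
  Arrow.homMk (u := 𝟙 f.left) (v := F.snd f) ((Category.id_comp _).trans (F.fst_snd f).symm)

/-- The unit of the right functor as a square. -/
abbrev unitSq (f : Arrow C) : f ⟶ Arrow.mk (F.snd f) :=
  Arrow.homMk (u := F.fst f) (v := 𝟙 f.right) ((F.fst_snd f).trans (Category.comp_id _).symm)

/-- Data that turn a functorial factorisation into an algebraic weak factorisation system: a class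
of maps between the central objects which are determined by their restriction and their
projection, with structure maps `δ` and `μ` in this class. -/
structure CellularData where
  Cellular : ∀ {f g : Arrow C}, (F.Z.obj f ⟶ F.Z.obj g) → Prop
  id : ∀ f : Arrow C, Cellular (𝟙 (F.Z.obj f))
  comp : ∀ {f g h : Arrow C} {a : F.Z.obj f ⟶ F.Z.obj g} {b : F.Z.obj g ⟶ F.Z.obj h},
    Cellular a → Cellular b → Cellular (a ≫ b)
  map : ∀ {f g : Arrow C} (α : f ⟶ g), Cellular (F.Z.map α)
  ext : ∀ {f g : Arrow C} {a b : F.Z.obj f ⟶ F.Z.obj g}, Cellular a → Cellular b →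
    F.fst f ≫ a = F.fst f ≫ b → a ≫ F.snd g = b ≫ F.snd g → a = b
  δ : ∀ f : Arrow C, F.Z.obj f ⟶ F.Z.obj (Arrow.mk (F.fst f))
  cellular_δ : ∀ f, Cellular (δ f)
  fst_δ : ∀ f, F.fst f ≫ δ f = F.fst (Arrow.mk (F.fst f))
  δ_snd : ∀ f, δ f ≫ F.snd (Arrow.mk (F.fst f)) = 𝟙 (F.Z.obj f)
  μ : ∀ f : Arrow C, F.Z.obj (Arrow.mk (F.snd f)) ⟶ F.Z.obj f
  cellular_μ : ∀ f, Cellular (μ f)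
  fst_μ : ∀ f, F.fst (Arrow.mk (F.snd f)) ≫ μ f = 𝟙 (F.Z.obj f)
  μ_snd : ∀ f, μ f ≫ F.snd f = F.snd (Arrow.mk (F.snd f))

namespace CellularData

variable {F} (D : CellularData F)

/-- The comultiplication as a square. -/
abbrev δSq (f : Arrow C) : Arrow.mk (F.fst f) ⟶ Arrow.mk (F.fst (Arrow.mk (F.fst f))) :=
  Arrow.homMk (u := 𝟙 f.left) (v := D.δ f) ((Category.id_comp _).trans (D.fst_δ f).symm)

/-- The multiplication as a square. -/
abbrev μSq (f : Arrow C) : Arrow.mk (F.snd (Arrow.mk (F.snd f))) ⟶ Arrow.mk (F.snd f) :=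
  Arrow.homMk (u := D.μ f) (v := 𝟙 f.right) ((D.μ_snd f).trans (Category.comp_id _).symm)

/-- The distributive law as a square. -/
abbrev ΔSq (f : Arrow C) :
    Arrow.mk (F.fst (Arrow.mk (F.snd f))) ⟶ Arrow.mk (F.snd (Arrow.mk (F.fst f))) :=
  Arrow.homMk (u := D.δ f) (v := D.μ f) ((D.δ_snd f).trans (D.fst_μ f).symm)

theorem fst_δ_assoc (f : Arrow C) {X : C} (a : F.Z.obj (Arrow.mk (F.fst f)) ⟶ X) :
    F.fst f ≫ D.δ f ≫ a = F.fst (Arrow.mk (F.fst f)) ≫ a := by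
  rw [← Category.assoc, D.fst_δ]

theorem δ_snd_assoc (f : Arrow C) {X : C} (a : F.Z.obj f ⟶ X) :
    D.δ f ≫ F.snd (Arrow.mk (F.fst f)) ≫ a = a :=
  (Category.assoc _ _ _).symm.trans
    ((congrArg (· ≫ a) (D.δ_snd f)).trans (Category.id_comp a))

theorem fst_μ_assoc (f : Arrow C) {X : C} (a : F.Z.obj f ⟶ X) :
    F.fst (Arrow.mk (F.snd f)) ≫ D.μ f ≫ a = a :=
  (Category.assoc _ _ _).symm.trans
    ((congrArg (· ≫ a) (D.fst_μ f)).trans (Category.id_comp a))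

theorem comp_fst_μ (f : Arrow C) {X : C} (a : X ⟶ F.Z.obj f) :
    a ≫ F.fst (Arrow.mk (F.snd f)) ≫ D.μ f = a :=
  (congrArg (a ≫ ·) (D.fst_μ f)).trans (Category.comp_id a)

theorem comp_δ_snd (f : Arrow C) {X : C} (a : X ⟶ F.Z.obj f) :
    a ≫ D.δ f ≫ F.snd (Arrow.mk (F.fst f)) = a :=
  (congrArg (a ≫ ·) (D.δ_snd f)).trans (Category.comp_id a)

theorem fst_map_assoc {f g : Arrow C} (α : f ⟶ g) {X : C} (a : F.Z.obj g ⟶ X) :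
    F.fst f ≫ F.Z.map α ≫ a = α.left ≫ F.fst g ≫ a := by
  rw [← Category.assoc, fst_map, Category.assoc]

/-- This and the other laws that `ext` must supply follow one pattern: both sides are cellular,
precomposition with `fst` reduces by `fst_δ` or `fst_μ`, and postcomposition with `snd` by `δ_snd`
or `μ_snd`. -/
theorem δ_naturality {f g : Arrow C} (α : f ⟶ g) :
    F.Z.map α ≫ D.δ g = D.δ f ≫ F.Z.map (F.fstSq α) := by
  refine D.ext (D.comp (D.map _) (D.cellular_δ _)) (D.comp (D.cellular_δ _) (D.map _)) ?_ ?_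
  · rw [fst_map_assoc, D.fst_δ, D.fst_δ_assoc]
    exact (F.fst_map (F.fstSq α)).symm
  · rw [Category.assoc, D.comp_δ_snd, Category.assoc, map_snd]
    exact (D.δ_snd_assoc f (F.Z.map α)).symm

theorem coassoc (f : Arrow C) :
    D.δ f ≫ F.Z.map (D.δSq f) = D.δ f ≫ D.δ (Arrow.mk (F.fst f)) := by
  refine D.ext (D.comp (D.cellular_δ _) (D.map _)) (D.comp (D.cellular_δ _) (D.cellular_δ _))
    ?_ ?_
  · rw [D.fst_δ_assoc, D.fst_δ_assoc, fst_map]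
    refine (Category.id_comp _).trans ?_
    exact (D.fst_δ (Arrow.mk (F.fst f))).symm
  · rw [Category.assoc, Category.assoc, map_snd, D.comp_δ_snd]
    exact D.δ_snd_assoc f (D.δ f)

theorem δ_map_counit (f : Arrow C) : D.δ f ≫ F.Z.map (F.counitSq f) = 𝟙 _ := by
  refine D.ext (D.comp (D.cellular_δ _) (D.map _)) (D.id _) ?_ ?_
  · rw [D.fst_δ_assoc, Category.comp_id, fst_map]
    exact Category.id_comp _
  · rw [Category.assoc, Category.id_comp, map_snd]
    exact D.δ_snd_assoc f (F.snd f)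

theorem μ_naturality {f g : Arrow C} (α : f ⟶ g) :
    F.Z.map (F.sndSq α) ≫ D.μ g = D.μ f ≫ F.Z.map α := by
  refine D.ext (D.comp (D.map _) (D.cellular_μ _)) (D.comp (D.cellular_μ _) (D.map _)) ?_ ?_
  · rw [D.fst_μ_assoc, fst_map_assoc]
    exact D.comp_fst_μ g (F.Z.map α)
  · rw [Category.assoc, Category.assoc, D.μ_snd, map_snd, map_snd, ← Category.assoc, D.μ_snd]
    rfl

theorem assoc (f : Arrow C) :
    F.Z.map (D.μSq f) ≫ D.μ f = D.μ (Arrow.mk (F.snd f)) ≫ D.μ f := by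
  refine D.ext (D.comp (D.map _) (D.cellular_μ _)) (D.comp (D.cellular_μ _) (D.cellular_μ _))
    ?_ ?_
  · rw [D.fst_μ_assoc, fst_map_assoc]
    exact D.comp_fst_μ f (D.μ f)
  · rw [Category.assoc, Category.assoc, D.μ_snd, D.μ_snd, map_snd]
    exact Category.comp_id _

theorem map_unit_μ (f : Arrow C) : F.Z.map (F.unitSq f) ≫ D.μ f = 𝟙 _ := by
  refine D.ext (D.comp (D.map _) (D.cellular_μ _)) (D.id _) ?_ ?_
  · rw [fst_map_assoc, Category.comp_id]
    exact D.comp_fst_μ f (F.fst f)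
  · rw [Category.assoc, Category.id_comp, D.μ_snd, map_snd]
    exact Category.comp_id _

/-- The only law that mixes `δ` and `μ` nontrivially. It is the left component of `Δ_mul` and the
right component of `Δ_comul`; the other two components are `assoc` and `coassoc`. -/
theorem μ_δ (f : Arrow C) : D.μ f ≫ D.δ f =
    D.δ (Arrow.mk (F.snd f)) ≫ F.Z.map (D.ΔSq f) ≫ D.μ (Arrow.mk (F.fst f)) := by
  refine D.ext (D.comp (D.cellular_μ _) (D.cellular_δ _))
    (D.comp (D.cellular_δ _) (D.comp (D.map _) (D.cellular_μ _))) ?_ ?_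
  · rw [D.fst_μ_assoc, D.fst_δ_assoc, fst_map_assoc]
    exact (D.comp_fst_μ (Arrow.mk (F.fst f)) (D.δ f)).symm
  · rw [Category.assoc, D.comp_δ_snd, Category.assoc, Category.assoc, D.μ_snd, map_snd]
    exact (D.δ_snd_assoc (Arrow.mk (F.snd f)) (D.μ f)).symm

/-- The algebraic weak factorisation system given by cellular data. -/
def algebraicWFS : AlgebraicWFS F where
  δ :=
    { app := D.δSq
      naturality := fun _ _ α => Arrow.hom_ext _ _
        ((Category.comp_id _).trans (Category.id_comp _).symm) (D.δ_naturality α) }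
  coassoc f := Arrow.hom_ext _ _ rfl (D.coassoc f)
  left_counit f := Arrow.hom_ext _ _ (Category.id_comp _) (D.δ_snd f)
  right_counit f := Arrow.hom_ext _ _ (Category.id_comp _) (D.δ_map_counit f)
  μ :=
    { app := D.μSq
      naturality := fun _ _ α => Arrow.hom_ext _ _ (D.μ_naturality α)
        ((Category.comp_id _).trans (Category.id_comp _).symm) }
  assoc f := Arrow.hom_ext _ _ (D.assoc f) rfl
  left_unit f := Arrow.hom_ext _ _ (D.fst_μ f) (Category.id_comp _)
  right_unit f := Arrow.hom_ext _ _ (D.map_unit_μ f) (Category.id_comp _)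
  Δ :=
    { app := D.ΔSq
      naturality := fun _ _ α => Arrow.hom_ext _ _ (D.δ_naturality α) (D.μ_naturality α) }
  Δ_left _ := rfl
  Δ_right _ := rfl
  Δ_unit f := Arrow.hom_ext _ _ (D.fst_δ f) (D.map_unit_μ f)
  Δ_counit f := Arrow.hom_ext _ _ (D.δ_map_counit f) (D.μ_snd f)
  Δ_mul f := Arrow.hom_ext _ _ (D.μ_δ f)
    ((D.assoc f).trans (congrArg (D.μ (Arrow.mk (F.snd f)) ≫ ·) (Category.comp_id _).symm))
  Δ_comul f := Arrow.hom_ext _ _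
    ((D.coassoc f).trans (Category.id_comp _).symm) (D.μ_δ f)

end CellularData

end FunctorialFactorisation

/-- Comonads on the same category agree if they agree in their values. -/
theorem CategoryTheory.Comonad.ext_of_app {C : Type v} [Category.{w} C] {G H : Comonad C}
    (h : G.toFunctor = H.toFunctor)
    (hε : ∀ X, G.ε.app X = eqToHom (Functor.congr_obj h X) ≫ H.ε.app X)
    (hδ : ∀ X, G.δ.app X ≫ eqToHom (Functor.congr_obj (congrArg (fun K => K ⋙ K) h) X) =
      eqToHom (Functor.congr_obj h X) ≫ H.δ.app X) : G = H := by
  obtain ⟨G, ε, δ, _, _, _⟩ := G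
  obtain ⟨H, ε', δ', _, _, _⟩ := H
  dsimp only at h
  subst h
  obtain rfl : ε = ε' := by ext X; simpa using hε X
  obtain rfl : δ = δ' := by ext X; simpa using hδ X
  rfl

/-! ### Cellular maps and their uniqueness into free cell complexes -/

namespace StrataSeq

/-- The characteristic maps of cells of dimension `n`. -/
inductive IsChar (A : StrataSeq.{u}) : ∀ n : ℕ, (disk.{u} n ⟶ A.body) → Prop
  | char (k : ℕ) (s : (A.st k).S) : IsChar A ((A.st k).κ s) (A.char k s)

theorem IsChar.eqToHom_comp {A : StrataSeq.{u}} {m n : ℕ} (h : m = n) {c : disk.{u} n ⟶ A.body}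
    (hc : A.IsChar n c) : A.IsChar m (eqToHom (congrArg disk.{u} h) ≫ c) := by
  subst h
  simpa using hc

theorem IsChar.exists_eq {A : StrataSeq.{u}} {n : ℕ} {c : disk.{u} n ⟶ A.body}
    (hc : A.IsChar n c) : ∃ (k : ℕ) (s : (A.st k).S) (h : n = (A.st k).κ s),
      c = eqToHom (congrArg disk.{u} h) ≫ A.char k s := by
  obtain ⟨k, s⟩ := hc
  exact ⟨k, s, rfl, (Category.id_comp _).symm⟩

/-- A map between bodies is cellular if it preserves the characteristic maps of cells. -/
def IsCellular {A B : StrataSeq.{u}} (v : A.body ⟶ B.body) : Prop :=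
  ∀ (n : ℕ) (c : disk.{u} n ⟶ A.body), A.IsChar n c → B.IsChar n (c ≫ v)

theorem isCellular_bodyMap {A B : StrataSeq.{u}} (φ : A ⟶ B) : IsCellular (bodyMap φ) := by
  rintro n c ⟨k, s⟩
  rw [char_bodyMap]
  exact (IsChar.char _ _).eqToHom_comp ((φ.φ k).hκ s)

theorem IsCellular.comp {A B C : StrataSeq.{u}} {a : A.body ⟶ B.body} {b : B.body ⟶ C.body}
    (ha : IsCellular a) (hb : IsCellular b) : IsCellular (a ≫ b) := by
  intro n c hc
  rw [← Category.assoc]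
  exact hb n _ (ha n c hc)

theorem isCellular_id (A : StrataSeq.{u}) : IsCellular (𝟙 A.body) := by
  intro n c hc
  rwa [Category.comp_id]

theorem isChar_newChar (Z : StrataSeq.{u}) (T : Stratum.{u}) (q : Z.body ⟶ T.X) {k : ℕ}
    (t : NewCell Z T q k) : (addStratum Z T q).IsChar (T.κ t.1) (newChar Z T q t) :=
  IsChar.char (A := addStratum Z T q) k (Sum.inr t)

theorem boundary_eqToHom_char (A : StrataSeq.{u}) {d k : ℕ} (s : (A.st k).S)
    (h : d = (A.st k).κ s) :
    diskBoundaryInclusion d ≫ eqToHom (congrArg disk.{u} h) ≫ A.char k s =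
      (eqToHom (congrArg diskBoundary.{u} h) ≫ (A.st k).b s) ≫ A.toBody k := by
  rw [← Category.assoc, Stratum.boundary_eqToHom h, Category.assoc, boundary_char, Category.assoc]

/-- If `k < l`, the attaching map of `t` would factor through stage `k`, because stage `l` embeds in
the body. Used in both directions, this recovers the level of a cell from its attaching map into the
body. -/
theorem IsProper.le_of_boundary_eq {A : StrataSeq.{u}} (hA : A.IsProper) {d k l : ℕ}
    {s : (A.st k).S} {t : (A.st l).S} (hs : d = (A.st k).κ s) (ht : d = (A.st l).κ t)
    (h : (eqToHom (congrArg diskBoundary.{u} hs) ≫ (A.st k).b s) ≫ A.toBody k =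
      (eqToHom (congrArg diskBoundary.{u} ht) ≫ (A.st l).b t) ≫ A.toBody l) : l ≤ k := by
  by_contra! hkl
  subst ht
  refine hA l t k hkl ⟨eqToHom (congrArg diskBoundary.{u} hs) ≫ (A.st k).b s, ?_⟩
  rw [← cancel_mono (A.toBody l), Category.assoc, trans_toBody, h]
  simp

end StrataSeq

/-- A characteristic map of the free cell complex on `f` is determined by its restriction to the
boundary and its image under `E f`. -/
theorem freeSeq_isChar_ext {f : Arrow TopCat.{u}} {n : ℕ} {c c' : disk.{u} n ⟶ (freeSeq f).body}
    (hc : (freeSeq f).IsChar n c) (hc' : (freeSeq f).IsChar n c')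
    (hb : diskBoundaryInclusion n ≫ c = diskBoundaryInclusion n ≫ c')
    (hE : c ≫ freeE f = c' ≫ freeE f) : c = c' := by
  obtain ⟨k, s, hs, rfl⟩ := hc.exists_eq
  obtain ⟨l, t, ht, rfl⟩ := hc'.exists_eq
  rw [StrataSeq.boundary_eqToHom_char _ s hs, StrataSeq.boundary_eqToHom_char _ t ht] at hb
  obtain rfl : k = l := le_antisymm
    ((freeSeq_isProper f).le_of_boundary_eq ht hs hb.symm)
    ((freeSeq_isProper f).le_of_boundary_eq hs ht hb)
  rw [cancel_mono] at hb
  rw [Category.assoc, Category.assoc, char_freeE, char_freeE] at hE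
  obtain rfl := freeSeq_cell_ext hs ht hb hE
  rfl

/-- A cellular map to a free cell complex is determined by its restriction to the boundary and its
composite with `E f`. -/
theorem freeSeq_isCellular_ext {C : StrataSeq.{u}} {f : Arrow TopCat.{u}}
    {a b : C.body ⟶ (freeSeq f).body} (ha : StrataSeq.IsCellular a) (hb : StrataSeq.IsCellular b)
    (h₀ : C.toBody 0 ≫ a = C.toBody 0 ≫ b) (hE : a ≫ freeE f = b ≫ freeE f) : a = b := by
  refine C.body_hom_ext fun n => ?_
  induction n with
  | zero => exact h₀
  | succ n ih =>
    refine C.step_hom_ext ?_ fun s => ?_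
    · rw [← Category.assoc, ← Category.assoc, StrataSeq.step_toBody, ih]
    -- The two images are characteristic maps, possibly at a level other than `n`; their boundaries
    -- agree by induction and their projections by `hE`.
    · have : C.char n s ≫ a = C.char n s ≫ b := by
        refine freeSeq_isChar_ext (ha _ _ (.char n s)) (hb _ _ (.char n s)) ?_ ?_
        · rw [← Category.assoc, ← Category.assoc, StrataSeq.boundary_char, Category.assoc, ih,
            Category.assoc]
        · rw [Category.assoc, Category.assoc, hE]
      simpa only [StrataSeq.char, Category.assoc] using this

/-! ### The multiplication obtained from composites -/

namespace CellCx.Composite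

variable {A B : CellCx.{u}} {e : A.obj.body = B.obj.X 0} (c : CellCx.Composite A B e)

/-- The identification of the body of a composite with the body of the second complex. -/
def bodyIso : c.cocone.pt.body ≅ B.obj.body where
  hom := c.iso.hom.right
  inv := c.iso.inv.right
  hom_inv_id := congrArg Arrow.Hom.right c.iso.hom_inv_id
  inv_hom_id := congrArg Arrow.Hom.right c.iso.inv_hom_id

/-- The canonical morphism from a stack to the composite. -/
def ofStack (n : ℕ) : StrataSeq.stack A.obj B.obj e n ⟶ c.cocone.pt := c.cocone.ι.app n

theorem bodyMap_ofStack (n : ℕ) : StrataSeq.bodyMap (c.ofStack n) ≫ c.bodyIso.hom =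
    StrataSeq.stackBody A.obj B.obj e n ≫ B.obj.toBody n :=
  c.iso_right n

/-- In a composite `B * A`, the cells of `B` are cells of the composite. -/
theorem isCellular_bodyIso_inv : StrataSeq.IsCellular c.bodyIso.inv := by
  rintro n _ ⟨k, t⟩
  -- The cell `t` as it appears in the stack right after the `k`-th stratum of `B` is added, at
  -- whichever level it was attached.
  let x : disk.{u} ((B.obj.st k).κ t) ⟶ (StrataSeq.stack A.obj B.obj e (k + 1)).body :=
    StrataSeq.newChar _ _ _ (StrataSeq.newCell (StrataSeq.stack A.obj B.obj e k)
      (B.obj.st k) (StrataSeq.stackBody A.obj B.obj e k) t)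
  have hx : x ≫ StrataSeq.stackBody A.obj B.obj e (k + 1) =
      (B.obj.st k).cell t ≫ (B.obj.glue k).hom :=
    (Category.assoc _ _ _).symm.trans
      (congrArg (· ≫ (B.obj.glue k).hom) (StrataSeq.newChar_addStratumBody _ _ _ _))
  have hc : B.obj.char k t ≫ c.bodyIso.inv = x ≫ StrataSeq.bodyMap (c.ofStack (k + 1)) := by
    rw [Iso.comp_inv_eq, Category.assoc, bodyMap_ofStack, ← Category.assoc, hx, Category.assoc,
      StrataSeq.char]
  rw [hc]
  exact StrataSeq.isCellular_bodyMap (c.ofStack (k + 1)) _ _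
    (StrataSeq.isChar_newChar (StrataSeq.stack A.obj B.obj e k) (B.obj.st k)
      (StrataSeq.stackBody A.obj B.obj e k) (StrataSeq.newCell _ _ _ t))

end CellCx.Composite

namespace FreeComposite

variable {f : Arrow TopCat.{u}} (h : FreeProperty.{u}) (c : FreeComposite f)

theorem U_map_equiv : CellCx.U.map (h.equiv c.cx f c.toArrow) ≫ freeCounit f = c.toArrow :=
  (h.equiv c.cx f).symm_apply_apply c.toArrow

/-- The morphism `K E f * K f ⟶ K f` that corresponds to `(1, E E f)`. -/
def mulHom : c.cocone.pt ⟶ freeSeq f := (h.equiv c.cx f c.toArrow).hom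

theorem mul_eq : c.mul h = c.bodyIso.inv ≫ StrataSeq.bodyMap (c.mulHom h) := rfl

theorem mulHom_f : ((c.mulHom h).φ 0).f = c.iso.hom.left :=
  (Category.comp_id _).symm.trans
    ((congrArg Arrow.Hom.left (c.U_map_equiv h)).trans (Category.comp_id _))

theorem bodyMap_mulHom : StrataSeq.bodyMap (c.mulHom h) ≫ freeE f =
    c.bodyIso.hom ≫ freeE (Arrow.mk (freeE f)) :=
  congrArg Arrow.Hom.right (c.U_map_equiv h)

theorem isCellular_mul : StrataSeq.IsCellular (c.mul h) :=
  (CellCx.Composite.isCellular_bodyIso_inv c).comp (StrataSeq.isCellular_bodyMap (c.mulHom h))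

theorem mul_freeE : c.mul h ≫ freeE f = freeE (Arrow.mk (freeE f)) := by
  rw [mul_eq]
  refine (Category.assoc _ _ _).trans
    ((congrArg (c.bodyIso.inv ≫ ·) (c.bodyMap_mulHom h)).trans ?_)
  exact Iso.inv_hom_id_assoc c.bodyIso _

/-- The canonical morphism `K f ⟶ K E f * K f`. -/
def inlHom : freeSeq f ⟶ c.cocone.pt := c.ofStack 0

theorem bodyMap_inlHom : StrataSeq.bodyMap c.inlHom ≫ c.bodyIso.hom =
    (freeSeq (Arrow.mk (freeE f))).toBody 0 :=
  (c.bodyMap_ofStack 0).trans (Category.id_comp _)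

/-- The restriction is the body of the composite of the inclusion `inlHom` with `mulHom`. This is an
endomorphism of the free complex compatible with the boundary and with `freeE`, hence the identity
by freeness. -/
theorem toBody_mul :
    (freeSeq (Arrow.mk (freeE f))).toBody 0 ≫ c.mul h = 𝟙 (freeSeq f).body := by
  have h₁ : (freeSeq (Arrow.mk (freeE f))).toBody 0 ≫ c.mul h =
      StrataSeq.bodyMap (c.inlHom ≫ c.mulHom h) := by
    rw [← bodyMap_inlHom c, mul_eq, StrataSeq.bodyMap_comp]
    exact (Category.assoc _ _ _).trans
      (congrArg (StrataSeq.bodyMap c.inlHom ≫ ·) (Iso.hom_inv_id_assoc c.bodyIso _))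
  refine h₁.trans (.trans ?_ (StrataSeq.bodyMap_id _))
  congr 1
  refine freeSeq_hom_ext ?_ ?_
  · rw [StrataSeq.comp_φ, Stratum.comp_f, mulHom_f]
    exact c.iso_left
  · rw [StrataSeq.bodyMap_comp, Category.assoc, bodyMap_mulHom, StrataSeq.bodyMap_id,
      Category.id_comp]
    refine (Category.assoc _ _ _).symm.trans ?_
    exact (congrArg (· ≫ freeE (Arrow.mk (freeE f))) c.bodyMap_inlHom).trans
      (toBody_freeE (Arrow.mk (freeE f)))

/-- The multiplication does not depend on the choice of the composite. -/
theorem mul_unique (c' : FreeComposite f) : c.mul h = c'.mul h :=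
  freeSeq_isCellular_ext (c.isCellular_mul h) (c'.isCellular_mul h)
    ((c.toBody_mul h).trans (c'.toBody_mul h).symm)
    ((c.mul_freeE h).trans (c'.mul_freeE h).symm)

end FreeComposite

/-! ### The comultiplication and the comparison with the comonad of the adjunction -/

namespace FreeProperty

variable (h : FreeProperty.{u})

/-- The morphism `K f ⟶ K U K f` that corresponds to the identity. -/
def comulHom (f : Arrow TopCat.{u}) : freeCx f ⟶ freeCx (CellCx.U.obj (freeCx f)) :=
  h.equiv (freeCx f) (CellCx.U.obj (freeCx f)) (𝟙 _)

theorem U_map_comulHom (f : Arrow TopCat.{u}) :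
    CellCx.U.map (h.comulHom f) ≫ freeCounit _ = 𝟙 (CellCx.U.obj (freeCx f)) :=
  (h.equiv (freeCx f) (CellCx.U.obj (freeCx f))).symm_apply_apply _

theorem U_map_comulHom_left (f : Arrow TopCat.{u}) :
    (CellCx.U.map (h.comulHom f)).left = 𝟙 f.left :=
  (Category.comp_id _).symm.trans (congrArg Arrow.Hom.left (h.U_map_comulHom f))

theorem U_map_K_map_left {f g : Arrow TopCat.{u}} (α : f ⟶ g) :
    (CellCx.U.map (h.K.map α)).left = α.left :=
  (Category.comp_id _).symm.trans
    ((congrArg Arrow.Hom.left (h.U_map_K_map α)).trans (Category.id_comp _))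

/-- The multiplication for some composite of `K f` and `K E f`. -/
def mul (f : Arrow TopCat.{u}) : (freeSeq (Arrow.mk (freeE f))).body ⟶ (freeSeq f).body :=
  FreeComposite.mul h
    (CellCx.nonempty_composite (freeCx f) (freeCx (Arrow.mk (freeE f))) rfl).some

/-- The cellular maps between the bodies of free cell complexes. -/
def cellularData : (cellFactorisation h).CellularData where
  Cellular {f g} v := StrataSeq.IsCellular (A := freeSeq f) (B := freeSeq g) v
  id f := StrataSeq.isCellular_id (freeSeq f)
  comp ha hb := ha.comp hb
  map α := StrataSeq.isCellular_bodyMap (h.K.map α).hom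
  ext := freeSeq_isCellular_ext
  δ f := StrataSeq.bodyMap (h.comulHom f).hom
  cellular_δ f := StrataSeq.isCellular_bodyMap (h.comulHom f).hom
  fst_δ f := by
    have h₁ := Arrow.w (CellCx.U.map (h.comulHom f))
    rw [h.U_map_comulHom_left] at h₁
    exact h₁.symm.trans (Category.id_comp _)
  δ_snd f := congrArg Arrow.Hom.right (h.U_map_comulHom f)
  μ := h.mul
  cellular_μ _ := FreeComposite.isCellular_mul h _
  fst_μ _ := FreeComposite.toBody_mul h _
  μ_snd _ := FreeComposite.mul_freeE h _

/-- The functors agree definitionally on objects. On a square `α`, one has left side `α.left` and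
the other the boundary part of `K α`; these coincide because the counit is the identity on domains.
-/
theorem L_eq : (cellFactorisation h).L = h.comonad.toFunctor :=
  Functor.hext (fun _ => rfl) (fun _ _ α => heq_of_eq
    (Arrow.hom_ext _ _ (h.U_map_K_map_left α).symm rfl))

theorem comonad_eq : h.cellularData.algebraicWFS.comonad = h.comonad := by
  refine Comonad.ext_of_app h.L_eq (fun f => ?_) (fun f => ?_)
  · refine .trans ?_ (Category.id_comp _).symm
    refine .trans ?_ (show freeCounit f = CellCx.U.map (𝟙 (freeCx f)) ≫ freeCounit f from ?_)
    · rfl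
    · rw [CategoryTheory.Functor.map_id, Category.id_comp]
  · refine (Category.comp_id _).trans (.trans ?_ (Category.id_comp _).symm)
    exact Arrow.hom_ext _ _ (h.U_map_comulHom_left f).symm rfl

end FreeProperty

end

theorem proposition4p6 :
    ∃ h : FreeProperty.{u},
      (∀ (A B : CellCx.{u}) (e : A.obj.body = B.obj.X 0), Nonempty (CellCx.Composite A B e)) ∧
      ∃ W : AlgebraicWFS (cellFactorisation h),
        W.comonad = h.comonad ∧
        ∀ (f : Arrow TopCat.{u}) (c : FreeComposite f), (W.monad.μ.app f).left = c.mul h :=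
  ⟨freeProperty, CellCx.nonempty_composite, freeProperty.cellularData.algebraicWFS,
    -- The multiplication was built from one chosen composite; cellular uniqueness transfers the
    -- formula to every composite `c`.
    freeProperty.comonad_eq, fun f c => FreeComposite.mul_unique (f := f) freeProperty _ c⟩
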